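/- Let $k>2$ be an integer and let $w$ be an odd positive integer. A \emph{bi-graded Lie algebra of type $(k,w)$} is a real Lie algebra $\mathfrak g=\bigoplus_{(i,j)\in\mathbb Z^2}\mathfrak g_{i,j}$ with $[\mathfrak g_{i,j},\mathfrak g_{i',j'}]\subset\mathfrak g_{i+i',j+j'}$ that has a basis (called a \emph{frame}) $$E,\ x_0,\dots,x_k,\ y_1,\dots,y_k,\ z,\ n,\ a,\ b,\quad\text{together with one more element } c \text{ if and only if } w=\tfrac{k+1}{2},$$ such that the following two conditions hold. (1) $[E,x_j]=x_{j+1}$ for $0\le j\le k-1$; $[x_0,x_w]=y_1$ (where $x_w:=0$ if $w>k$); $[E,y_j]=y_{j+1}$ for $1\le j\le k-1$; $[x_0,y_k]=z$; $[E,z]=n$; $[a,b]=0$; $[a,E]=E$; $[b,E]=0$; $[a,x_0]=0$; $[b,x_0]=x_0$; and, if $w=\frac{k+1}{2}$, also $[c,b]=0$, $[a,c]=-c$, $[c,E]=-2a+kb$, $[c,x_0]=0$. (2) Each $\mathfrak g_{i,j}$ is the span of the frame elements of bi-degree $(i,j)$, where the bi-degrees are $x_j\mapsto(-j,-1)$,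 $y_j\mapsto(-(w+j-1),-2)$, $z\mapsto(-(w+k-1),-3)$, $n\mapsto(-(w+k),-3)$, $E\mapsto(-1,0)$, $a,b\mapsto(0,0)$, $c\mapsto(1,0)$. An isomorphism of bi-graded Lie algebras is a Lie algebra isomorphism that maps each homogeneous component onto the component of the same bi-degree. Put $$d(k,w)=\begin{cases}\left\lfloor\frac{l-w+1}{3}\right\rfloor & \text{if } k=2l+1,\\[2pt] \left\lfloor\frac{l-w-1}{3}\right\rfloor & \text{if } k=2l.\end{cases}$$ \textbf{Theorem.} The set of bi-graded Lie algebras of type $(k,w)$, considered up to isomorphism, is a $d(k,w)$-parametric family. Precisely: if $d=d(k,w)\ge 0$, there are a bijection $\Phi$ from $\mathbb R^{d}$ onto the set of isomorphism classes of bi-graded Lie algebras of type $(k,w)$ and an injective affine map $s$ from $\mathbb R^d$ to the space of arrays of structure constants such that, for every $t\in\mathbb R^d$, every algebra in the class $\Phi(t)$ has the structure constants $s(t)$ with respect to each of its frames. In particular, if $d(k,w)=0$, there is exactly one bi-graded Lie algebra of type $(k,w)$ up to isomorphism; if $d(k,w)<0$, there is none. -/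

import Mathlib

universe u

/-- A real Lie algebra graded by `ℤ × ℤ`. -/
structure BigradedLieAlgebra where
  carrier : Type u
  [lieRing : LieRing carrier]
  [lieAlgebra : LieAlgebra ℝ carrier]
  grading : ℤ × ℤ → Submodule ℝ carrier
  [graded : GradedLieAlgebra grading]

namespace BigradedLieAlgebra

instance : CoeSort BigradedLieAlgebra.{u} (Type u) := ⟨BigradedLieAlgebra.carrier⟩

attribute [instance] BigradedLieAlgebra.lieRing BigradedLieAlgebra.lieAlgebra
  BigradedLieAlgebra.graded

/-- Isomorphism of bi-graded Lie algebras: a Lie algebra isomorphism that maps each homogeneous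
component onto the component of the same bi-degree. -/
def Isomorphic (A B : BigradedLieAlgebra.{u}) : Prop :=
  ∃ φ : A ≃ₗ⁅ℝ⁆ B, ∀ (p : ℤ × ℤ) (v : A), φ v ∈ B.grading p ↔ v ∈ A.grading p

theorem isomorphic_equivalence : Equivalence Isomorphic.{u} where
  refl A := ⟨LieEquiv.refl, fun _ _ => Iff.rfl⟩
  symm := by
    rintro A B ⟨φ, hφ⟩
    refine ⟨φ.symm, fun p v => ?_⟩
    rw [← hφ p, LieEquiv.apply_symm_apply]
  trans := by
    rintro A B C ⟨φ, hφ⟩ ⟨ψ, hψ⟩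
    exact ⟨φ.trans ψ, fun p v => (hψ p (φ v)).trans (hφ p v)⟩

/-- Labels of the elements of the frame
`E, x₀, …, x_k, y₁, …, y_k, z, n, a, b`, together with `c` exactly when `w = (k + 1) / 2`.
The label of `y_j` is `y (j - 1)`. -/
inductive FrameIndex (k w : ℕ) : Type
  | E
  | x (j : Fin (k + 1))
  | y (j : Fin k)
  | z
  | n
  | a
  | b
  | c (h : 2 * w = k + 1)

/-- The bi-degree of each element of the frame. -/
def FrameIndex.bidegree {k w : ℕ} : FrameIndex k w → ℤ × ℤ
  | .E => (-1, 0)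
  | .x j => (-(j : ℤ), -1)
  | .y j => (-((w : ℤ) + (j : ℤ)), -2)
  | .z => (-((w : ℤ) + k - 1), -3)
  | .n => (-((w : ℤ) + k), -3)
  | .a => (0, 0)
  | .b => (0, 0)
  | .c _ => (1, 0)

section Frame

variable {k w : ℕ} {L : Type u} [LieRing L] [LieAlgebra ℝ L]

/-- The vector `x_j` of the frame for `0 ≤ j ≤ k`, and `0` for all other `j`. -/
noncomputable def frameX (e : Module.Basis (FrameIndex k w) ℝ L) (j : ℕ) : L :=
  if h : j < k + 1 then e (.x ⟨j, h⟩) else 0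

/-- The vector `y_j` of the frame for `1 ≤ j ≤ k`, and `0` for all other `j`. -/
noncomputable def frameY (e : Module.Basis (FrameIndex k w) ℝ L) (j : ℕ) : L :=
  if h : 1 ≤ j ∧ j ≤ k then e (.y ⟨j - 1, by omega⟩) else 0

/-- The structure constants of `L` in the basis `e`: `[e_p, e_q] = ∑ r, s p q r • e_r`. -/
noncomputable def structureConstants (e : Module.Basis (FrameIndex k w) ℝ L) :
    FrameIndex k w → FrameIndex k w → FrameIndex k w → ℝ :=
  fun p q r => e.repr ⁅e p, e q⁆ r

end Frame

/-- The basis `e` of the bi-graded Lie algebra `A` is a frame as in the definition of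
type `(k, w)`: it satisfies the prescribed commutation relations, and the bi-grading of `A` is
the one given by the bi-degrees of the elements of the frame. -/
structure IsFrame {k w : ℕ} (A : BigradedLieAlgebra.{u})
    (e : Module.Basis (FrameIndex k w) ℝ A) : Prop where
  E_x : ∀ j < k, ⁅e .E, frameX e j⁆ = frameX e (j + 1)
  x_x : ⁅frameX e 0, frameX e w⁆ = frameY e 1
  E_y : ∀ j, 1 ≤ j → j < k → ⁅e .E, frameY e j⁆ = frameY e (j + 1)
  x_y : ⁅frameX e 0, frameY e k⁆ = e .z
  E_z : ⁅e .E, e .z⁆ = e .n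
  a_b : ⁅e .a, e .b⁆ = 0
  c_b : ∀ h, ⁅e (.c h), e .b⁆ = 0
  a_c : ∀ h, ⁅e .a, e (.c h)⁆ = -e (.c h)
  a_E : ⁅e .a, e .E⁆ = e .E
  b_E : ⁅e .b, e .E⁆ = 0
  /-- The term `k b` makes `a - (k / 2) b, c, E` an `sl₂`-triple in which `x₀`, of `a`-weight `0`
  and killed by `c`, generates the irreducible module of dimension `k + 1`. -/
  c_E : ∀ h, ⁅e (.c h), e .E⁆ = (-2 : ℝ) • e .a + (k : ℝ) • e .b
  a_x : ⁅e .a, frameX e 0⁆ = 0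
  b_x : ⁅e .b, frameX e 0⁆ = frameX e 0
  c_x : ∀ h, ⁅e (.c h), frameX e 0⁆ = 0
  grading_eq : ∀ p : ℤ × ℤ, A.grading p = Submodule.span ℝ (e '' {i | i.bidegree = p})

/-- `A` is a bi-graded Lie algebra of type `(k, w)`. -/
def IsOfType (k w : ℕ) (A : BigradedLieAlgebra.{u}) : Prop :=
  ∃ e : Module.Basis (FrameIndex k w) ℝ A, A.IsFrame e

/-- Isomorphism of bi-graded Lie algebras of type `(k, w)`. -/
instance ofTypeSetoid (k w : ℕ) : Setoid {A : BigradedLieAlgebra.{u} // A.IsOfType k w} where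
  r A B := Isomorphic A.1 B.1
  iseqv :=
    ⟨fun A => isomorphic_equivalence.refl A.1, fun h => isomorphic_equivalence.symm h,
      fun h h' => isomorphic_equivalence.trans h h'⟩

/-- The set of all bi-graded Lie algebras of type `(k, w)`, up to isomorphism. -/
def Classes (k w : ℕ) : Type (u + 1) := Quotient (ofTypeSetoid.{u} k w)

/-- The bi-graded Lie algebras of type `(k, w)` form a `d`-parametric family: their isomorphism
classes are parametrized bijectively by `t ∈ ℝ ^ d` in such a way that the structure constants of
an algebra in the class with parameter `t`, with respect to any frame, are given by an injective
affine function of `t`. -/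
def IsParametricFamily (k w d : ℕ) : Prop :=
  ∃ (Φ : (Fin d → ℝ) ≃ Classes.{u} k w)
    (s : (Fin d → ℝ) →ᵃ[ℝ] (FrameIndex k w → FrameIndex k w → FrameIndex k w → ℝ)),
    Function.Injective s ∧
      ∀ (A : {A : BigradedLieAlgebra.{u} // A.IsOfType k w}) (t : Fin d → ℝ),
        Φ t = Quotient.mk (ofTypeSetoid.{u} k w) A →
          ∀ e : Module.Basis (FrameIndex k w) ℝ A.1, A.1.IsFrame e → structureConstants e = s t

/-- The number of parameters `d(k, w)`; here `/` on `ℤ` rounds down, and `l = k / 2` in `ℕ`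
for both `k = 2 l + 1` and `k = 2 l`. -/
def paramDim (k w : ℕ) : ℤ :=
  if Odd k then (((k / 2 : ℕ) : ℤ) - w + 1) / 3 else (((k / 2 : ℕ) : ℤ) - w - 1) / 3

end BigradedLieAlgebra

/-! The grading gives `[x_i, x_j] = α i j • y_{i+j-w+1}`, and the frame relations force all other
brackets, so an algebra of type `(k, w)` amounts to an array `α` normalized by `α 0 w = 1`. An
isomorphism rescales `E` and `x_0`; both sides of the bracket relation then scale alike, so `α` is
an invariant of the class. It remains to find the admissible arrays.

Uniqueness. Jacobi makes `α` antisymmetric and compatible with `ad E`, and its `n`-component for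
`x_0, x_j, x_l` ties `α 0 j` to `α 0 l` when `j + l = w + k` (`IsBracketArray`). The row `f = α 0`
determines `α`. Put `N = w + k - 1` and `P = ∑ (-1)^m f(m) (N choose m) X^m`. Antisymmetry and `ad
E` say that `f` changes sign under the binomial transform, so `P = -∑ f(t) (N choose t) X^t
(1-X)^(N-t)`. If `f` vanishes up to `r`, reflection kills its last `r` values, so `X^(r+1) (1-X)^r`
divides `P` while `deg P ≤ N - r`. If `f (r+1) ≠ 0`, this forces `3r + 1 ≤ N`, and `N = 3r + 2` is
excluded by comparing coefficients (`first_nonzero_bound`). Hence the entries `α 0 (w + 2m)` with `0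
≤ m ≤ d` determine `α` (`ext_of_coord`).

Existence. Let `Q(T, S, U)` be a symmetric translation-invariant form of degree `w + k - 2` and of
degree less than `k` in each variable. The factorial-normalized coefficients of `(S - U) Q`, up to
sign, form a bracket array. The Jacobi identity for three `x`'s becomes `(S-U) + (U-T) + (T-S) = 0`
for its `z`-part and `T(S-U) + S(U-T) + U(T-S) = 0` for its `n`-part. The monomials `disc^M quad^p
cubic^e` supply one array for each `m ≤ d`, triangular in the coordinates above
(`exists_triangular_array`). If `2w = k + 1`, then `d = 0` and the form is a power of the
discriminant, which is `SL₂`-invariant, so `c` acts as well. -/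

/-! ### A polynomial bound on the first nonzero coefficient. -/

open Polynomial in
theorem coeff_one_sub_X_pow_real (n m : ℕ) :
    ((1 - X : ℝ[X]) ^ n).coeff m = (-1) ^ m * (n.choose m : ℝ) := by
  have h : (1 - X : ℝ[X]) ^ n = ((1 + X : ℝ[X]) ^ n).comp (C (-1) * X) := by
    simp [sub_eq_add_neg]
  rw [h, comp_C_mul_X_coeff, coeff_one_add_X_pow, mul_comm]

open Polynomial in
/-- The polynomial `∑ (-1) ^ m * f m * (N choose m) * X ^ m`. -/
noncomputable def binomialPoly (N : ℕ) (f : ℕ → ℝ) : ℝ[X] :=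
  ∑ m ∈ Finset.range (N + 1), monomial m ((-1) ^ m * f m * (N.choose m : ℝ))

open Polynomial in
theorem coeff_binomialPoly (N : ℕ) (f : ℕ → ℝ) (m : ℕ) :
    (binomialPoly N f).coeff m = (-1) ^ m * f m * (N.choose m : ℝ) := by
  simp only [binomialPoly, finsetSum_coeff, coeff_monomial, Finset.sum_ite_eq', Finset.mem_range]
  split_ifs with h
  · rfl
  · rw [Nat.choose_eq_zero_of_lt (by omega)]; simp

open Polynomial in
-- Substituting the binomial transform for `f m` and using `(N choose m)(m choose t) = (N choose
-- t)(N-t choose m-t)` turns each inner sum into an expansion of `(1 - X)^(N-t)`. In this form,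
-- vanishing of `f` near `N` can be read off as divisibility by a power of `1 - X`.
theorem binomialPoly_eq_neg_sum (N : ℕ) (f : ℕ → ℝ)
    (hf : ∀ m ≤ N, -f m = ∑ t ∈ Finset.range (m + 1), (-1) ^ t * (m.choose t : ℝ) * f t) :
    binomialPoly N f =
      -∑ t ∈ Finset.range (N + 1), C (f t * N.choose t) * (X ^ t * (1 - X) ^ (N - t)) := by
  ext m
  simp only [coeff_binomialPoly, coeff_neg, finsetSum_coeff, coeff_C_mul, coeff_X_pow_mul',
    coeff_one_sub_X_pow_real]
  by_cases hm : m ≤ N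
  · rw [← Finset.sum_subset (s₁ := Finset.range (m + 1))]
    · have h := hf m hm
      have h' : f m = -∑ t ∈ Finset.range (m + 1), (-1) ^ t * (m.choose t : ℝ) * f t := by
        rw [← h]; ring
      rw [h', mul_neg, neg_mul, Finset.mul_sum, Finset.sum_mul]
      congr 1
      refine Finset.sum_congr rfl fun t ht => ?_
      have htm : t ≤ m := by simpa [Nat.lt_succ_iff] using ht
      rw [if_pos htm]
      have hc : (N.choose m : ℝ) * m.choose t = N.choose t * (N - t).choose (m - t) := by
        exact_mod_cast Nat.choose_mul (n := N) htm
      have hs : (-1 : ℝ) ^ m * (-1) ^ t = (-1) ^ (m - t) := by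
        obtain ⟨q, rfl⟩ := Nat.exists_eq_add_of_le htm
        rw [Nat.add_sub_cancel_left, pow_add, mul_right_comm, ← pow_add, ← two_mul, pow_mul]
        simp
      calc _ = ((-1 : ℝ) ^ m * (-1) ^ t) * (N.choose m * m.choose t) * f t := by ring
        _ = _ := by rw [hc, hs]; ring
    · intro t ht
      simp only [Finset.mem_range] at ht ⊢
      omega
    · intro t ht ht'
      simp only [Finset.mem_range] at ht ht'
      rw [if_neg (by omega), mul_zero]
  · rw [Nat.choose_eq_zero_of_lt (by omega)]
    simp only [Nat.cast_zero, mul_zero]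
    symm
    rw [neg_eq_zero]
    refine Finset.sum_eq_zero fun t ht => ?_
    simp only [Finset.mem_range] at ht
    rw [Nat.choose_eq_zero_of_lt (n := N - t) (k := m - t) (by omega)]
    simp

open Polynomial in
-- The polynomial attached to `f` has a zero of order at least `r + 1` at `0` and at least `r` at
-- `1`, but degree at most `N - r`. The borderline degree `N = 3r + 2` leaves a linear cofactor,
-- which is overdetermined.
theorem first_nonzero_bound (N : ℕ) (f : ℕ → ℝ)
    (hf : ∀ m ≤ N, -f m = ∑ t ∈ Finset.range (m + 1), (-1) ^ t * (m.choose t : ℝ) * f t)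
    (hr : ∀ j l, j + l = N + 1 → (l : ℝ) * (-1) ^ l * f j = j * (-1) ^ j * f l)
    (r : ℕ) (h0 : ∀ m ≤ r, f m = 0) (h1 : f (r + 1) ≠ 0) (hrN : r + 1 ≤ N) :
    3 * r + 1 ≤ N ∧ N ≠ 3 * r + 2 := by
  -- Reflection pairs `t` with `N + 1 - t`, which is at most `r` here and is not zero.
  have hend : ∀ t, N < t + r → t ≤ N → f t = 0 := by
    intro t ht htN
    have h := hr (N + 1 - t) t (by omega)
    rw [h0 (N + 1 - t) (by omega), mul_zero] at h
    have h2 : ((N + 1 - t : ℕ) : ℝ) ≠ 0 := by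
      have : N + 1 - t ≠ 0 := by omega
      exact_mod_cast this
    have h3 : ((-1 : ℝ)) ^ (N + 1 - t) ≠ 0 := by positivity
    simpa [h2, h3] using h.symm
  have hne : binomialPoly N f ≠ 0 := by
    intro h
    have h2 := coeff_binomialPoly N f (r + 1)
    rw [h, coeff_zero] at h2
    have h3 : (N.choose (r + 1) : ℝ) ≠ 0 := by exact_mod_cast (Nat.choose_pos hrN).ne'
    have h4 : ((-1 : ℝ)) ^ (r + 1) ≠ 0 := by positivity
    simp [h1, h3] at h2
  have hX : X ^ (r + 1) ∣ binomialPoly N f := by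
    rw [X_pow_dvd_iff]
    intro m hm
    rw [coeff_binomialPoly, h0 m (by omega)]
    simp
  have hX1 : (1 - X) ^ r ∣ binomialPoly N f := by
    rw [binomialPoly_eq_neg_sum N f hf, dvd_neg]
    refine Finset.dvd_sum fun t ht => ?_
    simp only [Finset.mem_range] at ht
    by_cases htr : N < t + r
    · rw [hend t htr (by omega)]; simp
    · exact Dvd.dvd.mul_left (Dvd.dvd.mul_left (pow_dvd_pow _ (by omega)) _) _
  have hcop : IsCoprime ((X : ℝ[X]) ^ (r + 1)) ((1 - X) ^ r) :=
    IsCoprime.pow ⟨1, 1, by ring⟩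
  obtain ⟨g, hg⟩ := hcop.mul_dvd hX hX1
  have hg0 : g ≠ 0 := by rintro rfl; simp [hg] at hne
  have hdeg : (binomialPoly N f).natDegree ≤ N - r := by
    rw [natDegree_le_iff_coeff_eq_zero]
    intro t ht
    rw [coeff_binomialPoly]
    by_cases htN : t ≤ N
    · rw [hend t (by omega) htN]; simp
    · rw [Nat.choose_eq_zero_of_lt (by omega)]; simp
  have hd1 : ((1 - X : ℝ[X]) ^ r).natDegree = r := by
    rw [natDegree_pow]
    have : (1 - X : ℝ[X]).natDegree = 1 := by
      rw [show (1 - X : ℝ[X]) = -(X - C 1) by simp, natDegree_neg, natDegree_X_sub_C]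
    rw [this, mul_one]
  have hX1ne : (1 - X : ℝ[X]) ^ r ≠ 0 := by
    refine pow_ne_zero _ fun h => ?_
    have := congrArg (eval 0) h
    simp at this
  have hdegeq : (binomialPoly N f).natDegree = r + 1 + r + g.natDegree := by
    rw [hg, natDegree_mul (mul_ne_zero (pow_ne_zero _ X_ne_zero) hX1ne) hg0,
      natDegree_mul (pow_ne_zero _ X_ne_zero) hX1ne, hd1, natDegree_X_pow]
  -- The degree count reads `2r + 1 + deg g ≤ N - r`. For `N = 3r + 2` the cofactor is `g = eX + c`;
  -- the two lowest coefficients and the top one are now compared with the relations on `f`.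
  refine ⟨by omega, fun hN => ?_⟩
  have hgd : g.natDegree ≤ 1 := by omega
  obtain ⟨e, c, hgec⟩ := exists_eq_X_add_C_of_natDegree_le_one hgd
  have hcoef : ∀ n, (-1) ^ (r + 1 + n) * f (r + 1 + n) * (N.choose (r + 1 + n) : ℝ)
      = c * ((-1) ^ n * (r.choose n : ℝ)) +
        (if 1 ≤ n then e * ((-1) ^ (n - 1) * (r.choose (n - 1) : ℝ)) else 0) := by
    intro n
    rw [← coeff_binomialPoly, hg, hgec, mul_assoc, add_comm (r + 1), coeff_X_pow_mul]
    rw [show (1 - X : ℝ[X]) ^ r * (C e * X + C c) =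
      C c * (1 - X) ^ r + C e * (X ^ 1 * (1 - X) ^ r) by ring]
    rw [coeff_add, coeff_C_mul, coeff_C_mul, coeff_X_pow_mul', coeff_one_sub_X_pow_real,
      coeff_one_sub_X_pow_real]
    split_ifs <;> simp
  -- At index `r + 1` only the last term of the binomial relation survives; if `r + 1` were even, it
  -- would read `-f (r+1) = f (r+1)`.
  have hodd : Even r := by
    by_contra hcon
    have hod : Odd r := by simpa using hcon
    have h := hf (r + 1) hrN
    rw [Finset.sum_range_succ, Finset.sum_eq_zero] at h
    · rw [(Nat.even_add_one.2 hcon).neg_one_pow] at h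
      simp at h
      apply h1
      linarith
    · intro t ht
      simp only [Finset.mem_range] at ht
      rw [h0 t (by omega), mul_zero]
  have hpr : (-1 : ℝ) ^ r = 1 := hodd.neg_one_pow
  have hf2 : 2 * f (r + 2) = (r + 2) * f (r + 1) := by
    have h := hf (r + 2) (by omega)
    rw [Finset.sum_range_succ, Finset.sum_range_succ, Finset.sum_eq_zero] at h
    · rw [pow_add, pow_add, hpr, Nat.choose_self, show r + 2 = r + 1 + 1 by rfl,
        Nat.choose_succ_self_right] at h
      push_cast at h
      linarith
    · intro t ht
      simp only [Finset.mem_range] at ht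
      rw [h0 t (by omega), mul_zero]
  -- The reflected index of `r + 1` is `N - r = 2r + 2`, the top degree of the polynomial.
  have hfr : (2 * r + 2 : ℝ) * f (r + 1) = -((r + 1) * f (2 * r + 2)) := by
    have h := hr (r + 1) (2 * r + 2) (by omega)
    rw [show 2 * r + 2 = 2 * (r + 1) by ring, pow_mul, pow_succ (-1 : ℝ) r, hpr] at h
    rw [show 2 * r + 2 = 2 * (r + 1) by ring]
    push_cast at h
    simp at h
    linarith
  have c0 := hcoef 0
  have c1 := hcoef 1
  have c2 := hcoef (r + 1)
  rw [show r + 1 + 1 = r + 2 by rfl] at c1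
  rw [show r + 1 + (r + 1) = 2 * r + 2 by ring] at c2
  simp [pow_succ, hpr, pow_mul] at c0 c1 c2
  have ch1 : (N.choose (r + 2) : ℝ) * (r + 2) = N.choose (r + 1) * (2 * r + 1) := by
    have h := Nat.choose_succ_right_eq N (r + 1)
    rw [show N - (r + 1) = 2 * r + 1 by omega] at h
    exact_mod_cast h
  have ch2 : (N.choose (r + 1) : ℝ) = 2 * N.choose (2 * r + 2) := by
    have h := Nat.choose_succ_right_eq N r
    rw [show N - r = 2 * (r + 1) by omega] at h
    have h2 : N.choose (2 * r + 2) = N.choose r := by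
      rw [← Nat.choose_symm (n := N) (k := r) (by omega)]
      congr 1
      omega
    rw [h2]
    have h3 : N.choose (r + 1) = 2 * N.choose r := by
      apply Nat.eq_of_mul_eq_mul_right (Nat.succ_pos r)
      rw [Nat.succ_eq_add_one, h]; ring
    exact_mod_cast h3
  have hb : (N.choose (r + 1) : ℝ) ≠ 0 := by exact_mod_cast (Nat.choose_pos hrN).ne'
  have hr1 : (r + 1 : ℝ) ≠ 0 := by positivity
  have hfr' : f (2 * r + 2) = -2 * f (r + 1) := by
    apply mul_left_cancel₀ hr1
    linarith
  rw [hfr'] at c2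
  -- `c = e` by reflection, `c = -2 e` by the binomial relation
  have hce : c = e := by
    have : c = -2 * f (r + 1) * N.choose (2 * r + 2) := by rw [← c0, ch2]; ring
    rw [this, ← c2]
  have hce2 : c = -2 * e := by
    have h4 : 2 * (f (r + 2) * N.choose (r + 2)) = f (r + 1) * N.choose (r + 1) * (2 * r + 1) := by
      calc _ = (2 * f (r + 2)) * N.choose (r + 2) := by ring
        _ = f (r + 1) * (N.choose (r + 2) * (r + 2)) := by rw [hf2]; ring
        _ = _ := by rw [ch1]; ring
    rw [c1] at h4
    have h5 : f (r + 1) * (N.choose (r + 1) : ℝ) = -c := by linarith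
    rw [h5] at h4
    linarith
  have hc : c = 0 := by linarith
  rw [hc] at c0
  simp [h1, hb] at c0

/-! ### Bracket arrays and their determination by few entries. -/

/-- The linear conditions on the coefficients `α i j` of the brackets
`[x_i, x_j] = α i j • y_{i + j - w + 1}` that determine these brackets. -/
structure IsBracketArray (k w : ℕ) (α : ℕ → ℕ → ℝ) : Prop where
  antisymm : ∀ i j, α i j = -α j i
  eq_zero_of_add_lt : ∀ i j, i + j < w → α i j = 0
  eq_zero_of_le_add : ∀ i j, w + k ≤ i + j → α i j = 0
  eq_zero_of_lt : ∀ i j, k < i → α i j = 0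
  step : ∀ i j, i + j + 1 < w + k → α (i + 1) j + α i (j + 1) = α i j
  reflect : ∀ j l, j + l = w + k → (l : ℝ) * (-1) ^ l * α 0 j = j * (-1) ^ j * α 0 l

namespace IsBracketArray

variable {k w : ℕ} {α β : ℕ → ℕ → ℝ}

theorem sub (hα : IsBracketArray k w α) (hβ : IsBracketArray k w β) :
    IsBracketArray k w (α - β) where
  antisymm i j := by
    simp only [Pi.sub_apply]; rw [hα.antisymm i j, hβ.antisymm i j]; ring
  eq_zero_of_add_lt i j h := by simp [hα.eq_zero_of_add_lt i j h, hβ.eq_zero_of_add_lt i j h]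
  eq_zero_of_le_add i j h := by simp [hα.eq_zero_of_le_add i j h, hβ.eq_zero_of_le_add i j h]
  eq_zero_of_lt i j h := by simp [hα.eq_zero_of_lt i j h, hβ.eq_zero_of_lt i j h]
  step i j h := by
    have h1 := hα.step i j h
    have h2 := hβ.step i j h
    simp only [Pi.sub_apply]; linarith
  reflect i j h := by
    have h1 := hα.reflect i j h
    have h2 := hβ.reflect i j h
    simp only [Pi.sub_apply, mul_sub]; linarith

/-- Solved for `α (i+1) j`, the step relation is a finite difference in `j`; iterating it `i` times
expresses row `i` through row `0`. -/
theorem eq_sum (hα : IsBracketArray k w α) (i j : ℕ) (h : i + j < w + k) :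
    α i j = ∑ t ∈ Finset.range (i + 1), (-1) ^ t * (i.choose t : ℝ) * α 0 (j + t) := by
  induction i generalizing j with
  | zero => simp
  | succ i ih =>
    have h1 : α (i + 1) j = α i j - α i (j + 1) := by
      rw [← hα.step i j (by omega)]; ring
    rw [h1, ih j (by omega), ih (j + 1) (by omega)]
    rw [Finset.sum_range_succ' _ (i + 1)]
    simp only [Nat.choose_succ_succ, Nat.cast_add, mul_add, add_mul, Finset.sum_add_distrib]
    rw [Finset.sum_range_succ (fun t => (-1 : ℝ) ^ (t + 1) * (i.choose (t + 1) : ℝ) *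
      α 0 (j + (t + 1)))]
    rw [Finset.sum_range_succ' (fun t => (-1 : ℝ) ^ t * (i.choose t : ℝ) * α 0 (j + t))]
    have h2 : ∑ t ∈ Finset.range (i + 1), (-1 : ℝ) ^ t * (i.choose t : ℝ) * α 0 (j + 1 + t) =
        -∑ t ∈ Finset.range (i + 1), (-1 : ℝ) ^ (t + 1) * (i.choose t : ℝ) * α 0 (j + (t + 1)) := by
      rw [← Finset.sum_neg_distrib]
      refine Finset.sum_congr rfl fun t _ => ?_
      rw [show j + 1 + t = j + (t + 1) by ring]; ring
    rw [h2]
    simp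
    ring

theorem neg_eq_sum (hα : IsBracketArray k w α) (m : ℕ) (h : m < w + k) :
    -α 0 m = ∑ t ∈ Finset.range (m + 1), (-1) ^ t * (m.choose t : ℝ) * α 0 t := by
  rw [← hα.antisymm m 0, hα.eq_sum m 0 (by omega)]
  simp

/-- A bracket array is determined by the entries `α 0 (w + 2 m)` for `m < D`, as soon as `D` is
large enough. -/
theorem eq_zero (hα : IsBracketArray k w α) (hw : Odd w) (D : ℕ)
    (hD : w + k ≤ 3 * (w + 2 * D) - 2 ∨ w + k = 3 * (w + 2 * D))
    (h0 : ∀ m < D, α 0 (w + 2 * m) = 0) : α = 0 := by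
  obtain ⟨v, rfl⟩ := hw
  have hlow : ∀ m < 2 * v + 1 + 2 * D, α 0 m = 0 := by
    intro m
    induction m using Nat.strong_induction_on with
    | _ m ih =>
      intro hm
      by_cases hmw : m < 2 * v + 1
      · exact hα.eq_zero_of_add_lt 0 m (by omega)
      · by_cases hmk : 2 * v + 1 + k ≤ m
        · exact hα.eq_zero_of_le_add 0 m (by omega)
        · obtain ⟨q, hq | hq⟩ := m.even_or_odd'
          -- For even `m` the last term of the sum is `+α 0 m`, so `2 α 0 m` is a combination of
          -- earlier entries; only odd indices are free.
          · have h := hα.neg_eq_sum m (by omega)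
            rw [Finset.sum_range_succ, Finset.sum_eq_zero] at h
            · rw [hq, pow_mul, ← hq] at h
              simp at h
              linarith
            · intro t ht
              simp only [Finset.mem_range] at ht
              rw [ih t ht (by omega), mul_zero]
          · have := h0 (q - v) (by omega)
            rwa [show 2 * v + 1 + 2 * (q - v) = m by omega] at this
  have hf : ∀ m, α 0 m = 0 := by
    by_contra! hcon
    classical
    set m := Nat.find hcon with hmdef
    have hm : α 0 m ≠ 0 := Nat.find_spec hcon
    have hlt : ∀ t < m, α 0 t = 0 := fun t ht => not_not.1 (Nat.find_min hcon ht)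
    have hmk : m < 2 * v + 1 + k := by
      by_contra hcon'
      exact hm (hα.eq_zero_of_le_add 0 m (by omega))
    have hmD : 2 * v + 1 + 2 * D ≤ m := by
      by_contra hcon'
      exact hm (hlow m (by omega))
    -- With `N = w + k - 1` and first nonzero index `m = r + 1`, the bound gives `3m - 1 ≤ w + k`
    -- and `w + k ≠ 3m`. Since `m ≥ w + 2D`, both alternatives of `hD` are impossible.
    have key := first_nonzero_bound (2 * v + k) (α 0)
      (fun t ht => hα.neg_eq_sum t (by omega))
      (fun j l h => hα.reflect j l (by omega)) (m - 1)
      (fun t ht => hlt t (by omega)) (by rwa [show m - 1 + 1 = m by omega]) (by omega)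
    omega
  funext i j
  by_cases hij : i + j < 2 * v + 1 + k
  · rw [hα.eq_sum i j hij]
    simp [hf]
  · exact hα.eq_zero_of_le_add i j (by omega)

theorem ext_of_coord (hα : IsBracketArray k w α) (hβ : IsBracketArray k w β) (hw : Odd w) (D : ℕ)
    (hD : w + k ≤ 3 * (w + 2 * D) - 2 ∨ w + k = 3 * (w + 2 * D))
    (h0 : ∀ m < D, α 0 (w + 2 * m) = β 0 (w + 2 * m)) : α = β :=
  sub_eq_zero.1 ((hα.sub hβ).eq_zero hw D hD fun m hm => by simp [h0 m hm])

end IsBracketArray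

/-! ### Bracket arrays from symmetric forms in three variables. -/

/-- The normalized coefficients `h s i j = s! i! j! q_{s i j}` of a symmetric translation-invariant
form `∑ q_{s i j} T ^ s S ^ i U ^ j` of degree `w + k - 2`, of degree less than `k` in each
variable. If `2 w = k + 1`, the form is moreover required to be `SL₂`-invariant. -/
structure IsTripleArray (k w : ℕ) (h : ℕ → ℕ → ℕ → ℝ) : Prop where
  swap_left : ∀ s i j, h s i j = h i s j
  swap_right : ∀ s i j, h s i j = h s j i
  eq_zero_of_le : ∀ s i j, k ≤ s → h s i j = 0
  translation : ∀ s i j, s + i + j + 3 = w + k → h (s + 1) i j + h s (i + 1) j + h s i (j + 1) = 0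
  special : 2 * w = k + 1 → ∀ s i j, s + i + j + 1 = w + k →
    (s : ℝ) * (k - s) * h (s - 1) i j + i * (k - i) * h s (i - 1) j
      + j * (k - j) * h s i (j - 1) = 0

/-- The array of coefficients `α i j` attached to a triple array. -/
noncomputable def bracketArray (k w : ℕ) (h : ℕ → ℕ → ℕ → ℝ) (i j : ℕ) : ℝ :=
  if i + j < w + k then
    (-1) ^ (w + k - 1 - (i + j)) * (i * h (w + k - 1 - (i + j)) (i - 1) j
      - j * h (w + k - 1 - (i + j)) i (j - 1))
  else 0

theorem bracketArray_of_add_eq {k w : ℕ} (h : ℕ → ℕ → ℕ → ℝ) {s i j : ℕ}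
    (hs : s + i + j + 1 = w + k) :
    bracketArray k w h i j = (-1) ^ s * (i * h s (i - 1) j - j * h s i (j - 1)) := by
  rw [bracketArray, if_pos (by omega), show w + k - 1 - (i + j) = s by omega]

theorem bracketArray_of_le {k w : ℕ} (h : ℕ → ℕ → ℕ → ℝ) {i j : ℕ} (hs : w + k ≤ i + j) :
    bracketArray k w h i j = 0 := by
  rw [bracketArray, if_neg (by omega)]

namespace IsTripleArray

variable {k w : ℕ} {h h' : ℕ → ℕ → ℕ → ℝ}

theorem eq_zero_of_le_mid (hh : IsTripleArray k w h) (s i j : ℕ) (hi : k ≤ i) : h s i j = 0 := by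
  rw [hh.swap_left, hh.eq_zero_of_le _ _ _ hi]

/-- If `Q` is the form with normalized coefficients `h`, then `(-1)^s α i j` are those of `(S - U)
Q`. The cyclic sum of `S - U` is zero, and the symmetry of `h` makes the terms cancel in pairs. -/
theorem jacobi_z (hh : IsTripleArray k w h) (i j l : ℕ) (hs : i + j + l + 1 = w + k) :
    (-1) ^ i * bracketArray k w h j l + (-1) ^ j * bracketArray k w h l i
      + (-1) ^ l * bracketArray k w h i j = 0 := by
  rw [bracketArray_of_add_eq h (s := i) (by omega), bracketArray_of_add_eq h (s := j) (by omega),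
    bracketArray_of_add_eq h (s := l) (by omega)]
  have e : ∀ m : ℕ, ((-1 : ℝ) ^ m) * (-1) ^ m = 1 := fun m => by
    rw [← mul_pow]; simp
  rw [← mul_assoc, ← mul_assoc, ← mul_assoc, e, e, e]
  rw [hh.swap_left i (j - 1) l, hh.swap_right (j - 1) i l, hh.swap_right i j (l - 1),
    hh.swap_left i (l - 1) j, hh.swap_left j (l - 1) i, hh.swap_right (l - 1) j i,
    hh.swap_right j l (i - 1), hh.swap_left j (i - 1) l, hh.swap_left l (i - 1) j,
    hh.swap_right (i - 1) l j, hh.swap_right l i (j - 1), hh.swap_left l (j - 1) i]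
  ring

/-- The extra factor `i` is multiplication by `T` on normalized coefficients, so this is `T(S-U) +
S(U-T) + U(T-S) = 0` times `Q`. -/
theorem jacobi_n (hh : IsTripleArray k w h) (i j l : ℕ) (hs : i + j + l = w + k) :
    (-1) ^ i * i * bracketArray k w h j l + (-1) ^ j * j * bracketArray k w h l i
      + (-1) ^ l * l * bracketArray k w h i j = 0 := by
  have key : ∀ i j l : ℕ, i + j + l = w + k → (-1) ^ i * i * bracketArray k w h j l =
      -(i * j * h (i - 1) (j - 1) l - i * l * h (i - 1) (l - 1) j) := by
    intro i j l hs
    rcases i with _ | i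
    · simp
    · rw [bracketArray_of_add_eq h (s := i) (by omega), Nat.add_sub_cancel,
        hh.swap_right i j (l - 1)]
      have e : ((-1 : ℝ) ^ i) * (-1) ^ i = 1 := by rw [← mul_pow]; simp
      calc _ = -(((-1 : ℝ) ^ i) * (-1) ^ i) * ((i + 1 : ℕ) *
            (j * h i (j - 1) l - l * h i (l - 1) j)) := by ring
        _ = _ := by rw [e]; ring
  rw [key i j l hs, key j l i (by omega), key l i j (by omega)]
  rw [hh.swap_left (i - 1) (j - 1) l, hh.swap_left (j - 1) (l - 1) i,
    hh.swap_left (l - 1) (i - 1) j]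
  ring

/-- Symmetry of `Q` gives antisymmetry, its degree bound the vanishing outside the range,
translation invariance of `(S - U) Q` the step relation, and `jacobi_n` with first index `0` the
reflection. -/
theorem isBracketArray (hh : IsTripleArray k w h) : IsBracketArray k w (bracketArray k w h) where
  antisymm i j := by
    by_cases hij : i + j < w + k
    · rw [bracketArray_of_add_eq h (s := w + k - 1 - (i + j)) (by omega),
        bracketArray_of_add_eq h (s := w + k - 1 - (i + j)) (i := j) (by omega),
        hh.swap_right _ (i - 1) j, hh.swap_right _ i (j - 1)]
      ring
    · rw [bracketArray_of_le h (by omega), bracketArray_of_le h (by omega), neg_zero]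
  eq_zero_of_add_lt i j hij := by
    by_cases hij : i + j < w + k
    · rw [bracketArray_of_add_eq h (s := w + k - 1 - (i + j)) (by omega),
        hh.eq_zero_of_le _ _ _ (by omega), hh.eq_zero_of_le _ _ _ (by omega)]
      ring
    · exact bracketArray_of_le h (by omega)
  eq_zero_of_le_add i j hij := bracketArray_of_le h hij
  eq_zero_of_lt i j hik := by
    by_cases hij : i + j < w + k
    · rw [bracketArray_of_add_eq h (s := w + k - 1 - (i + j)) (by omega),
        hh.eq_zero_of_le_mid _ _ _ (by omega), hh.eq_zero_of_le_mid _ _ _ (by omega)]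
      ring
    · exact bracketArray_of_le h (by omega)
  step i j hij := by
    set s := w + k - 2 - (i + j) with hs
    rw [bracketArray_of_add_eq h (s := s) (by omega), bracketArray_of_add_eq h (s := s) (by omega),
      bracketArray_of_add_eq h (s := s + 1) (by omega)]
    have h1 : (i : ℝ) * (h (s + 1) (i - 1) j + h s i j + h s (i - 1) (j + 1)) = 0 := by
      rcases i with _ | i
      · simp
      · rw [Nat.add_sub_cancel, hh.translation s i j (by omega), mul_zero]
    have h2 : (j : ℝ) * (h (s + 1) i (j - 1) + h s (i + 1) (j - 1) + h s i j) = 0 := by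
      rcases j with _ | j
      · simp
      · rw [Nat.add_sub_cancel, hh.translation s i j (by omega), mul_zero]
    simp only [Nat.add_sub_cancel, pow_succ, Nat.cast_add, Nat.cast_one]
    linear_combination (-1 : ℝ) ^ s * h1 - (-1 : ℝ) ^ s * h2
  reflect j l hjl := by
    have h1 := hh.jacobi_n 0 j l (by omega)
    have h2 : bracketArray k w h l 0 = -bracketArray k w h 0 l := by
      by_cases hl : l < w + k
      · rw [bracketArray_of_add_eq h (s := w + k - 1 - l) (by omega),
          bracketArray_of_add_eq h (s := w + k - 1 - l) (by omega), hh.swap_right _ (l - 1)]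
        ring
      · rw [bracketArray_of_le h (by omega), bracketArray_of_le h (by omega), neg_zero]
    rw [h2] at h1
    simp at h1
    linarith

/-- This says that `c` acts as a derivation on `[x_i, x_j]`. For `D = T²∂_T + S²∂_S + U²∂_U`, the
hypothesis is `D Q = (k-1)(T+S+U) Q`, while `D (S-U) = (S+U)(S-U)`. The factor `S - U` therefore
raises the weight `k - 1` to `k` in `S` and `U` only. -/
theorem special_bracketArray (hh : IsTripleArray k w h) (hkw : 2 * w = k + 1) (i j : ℕ) :
    (i : ℝ) * (k + 1 - i) * bracketArray k w h (i - 1) j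
      + j * (k + 1 - j) * bracketArray k w h i (j - 1)
      = (i + j - w) * (w + k - i - j) * bracketArray k w h i j := by
  rcases lt_trichotomy (i + j) (w + k + 1) with hij | hij | hij
  -- Here `t` is one more than the exponent of `T` that belongs to `α i j`; it is the exponent for
  -- both terms on the left.
  · obtain ⟨t, ht⟩ : ∃ t, t + i + j = w + k := ⟨w + k - i - j, by omega⟩
    have htR : (t : ℝ) = w + k - i - j := by
      have : (t : ℝ) + i + j = w + k := by exact_mod_cast ht
      linarith
    have hL : (t : ℝ) * bracketArray k w h i j =
        t * (-((-1) ^ t * (i * h (t - 1) (i - 1) j - j * h (t - 1) i (j - 1)))) := by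
      rcases t with _ | t
      · simp
      · rw [bracketArray_of_add_eq h (s := t) (by omega), Nat.add_sub_cancel, pow_succ]
        ring
    have h1 : (i : ℝ) * bracketArray k w h (i - 1) j =
        i * ((-1) ^ t * ((i - 1) * h t (i - 1 - 1) j - j * h t (i - 1) (j - 1))) := by
      rcases i with _ | i
      · simp
      · rw [Nat.add_sub_cancel, bracketArray_of_add_eq h (s := t) (by omega)]
        push_cast
        ring
    have h2 : (j : ℝ) * bracketArray k w h i (j - 1) =
        j * ((-1) ^ t * (i * h t (i - 1) (j - 1) - (j - 1) * h t i (j - 1 - 1))) := by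
      rcases j with _ | j
      · simp
      · rw [Nat.add_sub_cancel, bracketArray_of_add_eq h (s := t) (by omega)]
        push_cast
        ring
    have r1 : (i : ℝ) * ((t : ℝ) * (k - t) * h (t - 1) (i - 1) j
        + (i - 1) * (k - (i - 1)) * h t (i - 1 - 1) j + j * (k - j) * h t (i - 1) (j - 1)) = 0 := by
      rcases i with _ | i
      · simp
      · have := hh.special hkw t i j (by omega)
        rw [Nat.add_sub_cancel]
        push_cast
        rw [add_sub_cancel_right, this, mul_zero]
    have r2 : (j : ℝ) * ((t : ℝ) * (k - t) * h (t - 1) i (j - 1)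
        + i * (k - i) * h t (i - 1) (j - 1) + (j - 1) * (k - (j - 1)) * h t i (j - 1 - 1)) = 0 := by
      rcases j with _ | j
      · simp
      · have := hh.special hkw t i j (by omega)
        rw [Nat.add_sub_cancel]
        push_cast
        rw [add_sub_cancel_right, this, mul_zero]
    have e1 : (i + j - w : ℝ) = k - t := by rw [htR]; ring
    rw [e1, ← htR]
    linear_combination ((k : ℝ) + 1 - i) * h1 + ((k : ℝ) + 1 - j) * h2 - ((k : ℝ) - t) * hL
      + (-1) ^ t * r1 - (-1) ^ t * r2
  · have hz : ∀ a b, w + k ≤ a + b → bracketArray k w h a b = 0 := fun a b => bracketArray_of_le h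
    rw [hz _ _ (by omega), hz _ _ (by omega), hz _ _ (by omega)]
    ring
  · have hz : ∀ a b, w + k ≤ a + b → bracketArray k w h a b = 0 := fun a b => bracketArray_of_le h
    rw [hz _ _ (by omega), hz _ _ (by omega), hz _ _ (by omega)]
    ring

theorem add_smul (hh : IsTripleArray k w h) (c : ℝ) (hh' : IsTripleArray k w h') :
    IsTripleArray k w (h + c • h') where
  swap_left x i j := by
    simp only [Pi.add_apply, Pi.smul_apply]
    rw [hh.swap_left, hh'.swap_left]
  swap_right x i j := by
    simp only [Pi.add_apply, Pi.smul_apply]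
    rw [hh.swap_right, hh'.swap_right]
  eq_zero_of_le x i j hx := by
    simp [hh.eq_zero_of_le _ _ _ hx, hh'.eq_zero_of_le _ _ _ hx]
  translation x i j hx := by
    simp only [Pi.add_apply, Pi.smul_apply, smul_eq_mul]
    linear_combination hh.translation _ _ _ hx + c * hh'.translation _ _ _ hx
  special hkw x i j hx := by
    simp only [Pi.add_apply, Pi.smul_apply, smul_eq_mul]
    linear_combination hh.special hkw _ _ _ hx + c * hh'.special hkw _ _ _ hx

protected theorem zero : IsTripleArray k w 0 := by
  constructor <;> simp

theorem sum {ι : Type*} (s : Finset ι) (c : ι → ℝ) (f : ι → ℕ → ℕ → ℕ → ℝ)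
    (hf : ∀ a, IsTripleArray k w (f a)) : IsTripleArray k w (∑ a ∈ s, c a • f a) := by
  classical
  induction s using Finset.induction_on with
  | empty => simpa using IsTripleArray.zero
  | insert a s ha ih =>
    rw [Finset.sum_insert ha, add_comm]
    exact ih.add_smul (c a) (hf a)

end IsTripleArray

theorem bracketArray_add_smul (k w : ℕ) (h h' : ℕ → ℕ → ℕ → ℝ) (c : ℝ) :
    bracketArray k w (h + c • h') = bracketArray k w h + c • bracketArray k w h' := by
  funext i j
  simp only [bracketArray, Pi.add_apply, Pi.smul_apply, smul_eq_mul]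
  split_ifs <;> ring

theorem bracketArray_sum {ι : Type*} (k w : ℕ) (s : Finset ι) (c : ι → ℝ)
    (f : ι → ℕ → ℕ → ℕ → ℝ) :
    bracketArray k w (∑ a ∈ s, c a • f a) = ∑ a ∈ s, c a • bracketArray k w (f a) := by
  classical
  induction s using Finset.induction_on with
  | empty => funext i j; simp [bracketArray]
  | insert a s ha ih =>
    rw [Finset.sum_insert ha, add_comm, bracketArray_add_smul, ih, Finset.sum_insert ha, add_comm]

/-! ### Translation-invariant symmetric forms and their coefficients. -/

section Forms

open MvPolynomial

/-- The exponent of `T ^ s S ^ i U ^ j`. -/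
noncomputable def tripleExp (s i j : ℕ) : Fin 3 →₀ ℕ :=
  Finsupp.single 0 s + Finsupp.single 1 i + Finsupp.single 2 j

@[simp] theorem tripleExp_zero (s i j : ℕ) : tripleExp s i j 0 = s := by simp [tripleExp]
@[simp] theorem tripleExp_one (s i j : ℕ) : tripleExp s i j 1 = i := by simp [tripleExp]
@[simp] theorem tripleExp_two (s i j : ℕ) : tripleExp s i j 2 = j := by simp [tripleExp]

theorem eq_tripleExp (m : Fin 3 →₀ ℕ) : m = tripleExp (m 0) (m 1) (m 2) := by
  ext a; fin_cases a <;> simp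

/-- The coefficients of a form in three variables multiplied by the factorials of the exponents. -/
noncomputable def tripleCoeff (Q : MvPolynomial (Fin 3) ℝ) (s i j : ℕ) : ℝ :=
  s.factorial * i.factorial * j.factorial * Q.coeff (tripleExp s i j)

variable {Q : MvPolynomial (Fin 3) ℝ}

theorem tripleCoeff_swap_left (hQ : rename (Equiv.swap 0 1) Q = Q) (s i j : ℕ) :
    tripleCoeff Q s i j = tripleCoeff Q i s j := by
  unfold tripleCoeff
  have h := coeff_rename_mapDomain (Equiv.swap (0 : Fin 3) 1) (Equiv.injective _) Q
    (tripleExp s i j)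
  rw [hQ, tripleExp, Finsupp.mapDomain_add, Finsupp.mapDomain_add, Finsupp.mapDomain_single,
    Finsupp.mapDomain_single, Finsupp.mapDomain_single, Equiv.swap_apply_left,
    Equiv.swap_apply_right, Equiv.swap_apply_of_ne_of_ne (by decide) (by decide)] at h
  rw [tripleExp, tripleExp, ← h, add_comm (Finsupp.single 1 s)]
  ring

theorem tripleCoeff_swap_right (hQ : rename (Equiv.swap 1 2) Q = Q) (s i j : ℕ) :
    tripleCoeff Q s i j = tripleCoeff Q s j i := by
  unfold tripleCoeff
  have h := coeff_rename_mapDomain (Equiv.swap (1 : Fin 3) 2) (Equiv.injective _) Q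
    (tripleExp s i j)
  rw [hQ, tripleExp, Finsupp.mapDomain_add, Finsupp.mapDomain_add, Finsupp.mapDomain_single,
    Finsupp.mapDomain_single, Finsupp.mapDomain_single, Equiv.swap_apply_left,
    Equiv.swap_apply_right, Equiv.swap_apply_of_ne_of_ne (by decide) (by decide)] at h
  rw [tripleExp, tripleExp, ← h, add_right_comm]
  ring

theorem tripleCoeff_eq_zero (s i j : ℕ) (h : Q.degreeOf 0 < s) : tripleCoeff Q s i j = 0 := by
  unfold tripleCoeff
  rw [notMem_support_iff.1 (notMem_support_of_degreeOf_lt 0 (by simpa using h)), mul_zero]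

theorem tripleCoeff_translation (hQ : pderiv 0 Q + pderiv 1 Q + pderiv 2 Q = 0) (s i j : ℕ) :
    tripleCoeff Q (s + 1) i j + tripleCoeff Q s (i + 1) j + tripleCoeff Q s i (j + 1) = 0 := by
  have h := congrArg (coeff (tripleExp s i j)) hQ
  simp only [coeff_add, coeff_pderiv, coeff_zero, tripleExp_zero, tripleExp_one,
    tripleExp_two] at h
  rw [eq_tripleExp (tripleExp s i j + Finsupp.single 0 1),
    eq_tripleExp (tripleExp s i j + Finsupp.single 1 1),
    eq_tripleExp (tripleExp s i j + Finsupp.single 2 1)] at h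
  simp at h
  simp only [tripleCoeff, Nat.factorial_succ]
  push_cast
  linear_combination (s.factorial * i.factorial * j.factorial : ℝ) * h

theorem coeff_X_mul_pderiv (a : Fin 3) (Q : MvPolynomial (Fin 3) ℝ) (m : Fin 3 →₀ ℕ) :
    coeff m (X a * pderiv a Q) = m a * coeff m Q := by
  rw [coeff_X_mul']
  split_ifs with h
  · have h1 : m a ≠ 0 := by simpa using h
    rw [coeff_pderiv]
    have h2 : m - Finsupp.single a 1 + Finsupp.single a 1 = m := by
      refine tsub_add_cancel_of_le ?_
      rw [Finsupp.single_le_iff]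
      omega
    rw [h2]
    have h3 : (((m - Finsupp.single a 1 : Fin 3 →₀ ℕ) a : ℕ) : ℝ) + 1 = m a := by
      have : (m - Finsupp.single a 1 : Fin 3 →₀ ℕ) a + 1 = m a := by
        rw [Finsupp.tsub_apply, Finsupp.single_eq_same]; omega
      exact_mod_cast this
    rw [h3, mul_comm]
  · have h1 : m a = 0 := by simpa using h
    rw [h1]; simp

/-- The factor `n (κ + 1 - n)` arises because `X²∂ - κX` sends `X^(n-1)` to `(n - 1 - κ) X^n`, and
passing from `(n-1)!` to `n!` contributes the `n`. -/
theorem tripleCoeff_special (κ : ℝ)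
    (hQ : X 0 * (X 0 * pderiv 0 Q) + X 1 * (X 1 * pderiv 1 Q) + X 2 * (X 2 * pderiv 2 Q)
      = C κ * (X 0 * Q + X 1 * Q + X 2 * Q)) (s i j : ℕ) :
    (s : ℝ) * (κ + 1 - s) * tripleCoeff Q (s - 1) i j
      + i * (κ + 1 - i) * tripleCoeff Q s (i - 1) j
      + j * (κ + 1 - j) * tripleCoeff Q s i (j - 1) = 0 := by
  have key : ∀ (a : Fin 3) (m : Fin 3 →₀ ℕ), coeff m (X a * (X a * pderiv a Q))
      - κ * coeff m (X a * Q) =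
      if m a = 0 then 0 else -((κ + 1 - m a) * coeff (m - Finsupp.single a 1) Q) := by
    intro a m
    rw [coeff_X_mul' m a (X a * pderiv a Q), coeff_X_mul' m a Q]
    by_cases h : m a = 0
    · simp [h]
    · have h' : a ∈ m.support := by simpa using h
      rw [if_pos h', if_pos h', if_neg h, coeff_X_mul_pderiv, Finsupp.tsub_apply,
        Finsupp.single_eq_same, Nat.cast_sub (by omega)]
      push_cast
      ring
  have h := congrArg (coeff (tripleExp s i j)) hQ
  simp only [coeff_add, coeff_C_mul] at h
  have h0 := key 0 (tripleExp s i j)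
  have h1 := key 1 (tripleExp s i j)
  have h2 := key 2 (tripleExp s i j)
  rw [eq_tripleExp (tripleExp s i j - Finsupp.single 0 1)] at h0
  rw [eq_tripleExp (tripleExp s i j - Finsupp.single 1 1)] at h1
  rw [eq_tripleExp (tripleExp s i j - Finsupp.single 2 1)] at h2
  simp only [Finsupp.tsub_apply, tripleExp_zero, tripleExp_one, tripleExp_two,
    Finsupp.single_eq_same, Fin.isValue, Finsupp.single_apply, Fin.reduceEq, if_false,
    tsub_zero] at h0 h1 h2
  have t : ∀ n : ℕ, (n : ℝ) * (n - 1).factorial = if n = 0 then 0 else (n.factorial : ℝ) := by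
    intro n
    rcases n with _ | n
    · simp
    · simp [Nat.factorial_succ]
  simp only [tripleCoeff]
  have e0 : (s : ℝ) * (κ + 1 - s) * ((s - 1).factorial * i.factorial * j.factorial *
      coeff (tripleExp (s - 1) i j) Q) = -(s.factorial * i.factorial * j.factorial) *
      (if s = 0 then 0 else -((κ + 1 - s) * coeff (tripleExp (s - 1) i j) Q)) := by
    have := t s
    split_ifs at this ⊢ with hs
    · simp [hs]
    · rw [← this]; ring
  have e1 : (i : ℝ) * (κ + 1 - i) * (s.factorial * (i - 1).factorial * j.factorial *
      coeff (tripleExp s (i - 1) j) Q) = -(s.factorial * i.factorial * j.factorial) *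
      (if i = 0 then 0 else -((κ + 1 - i) * coeff (tripleExp s (i - 1) j) Q)) := by
    have := t i
    split_ifs at this ⊢ with hs
    · simp [hs]
    · rw [← this]; ring
  have e2 : (j : ℝ) * (κ + 1 - j) * (s.factorial * i.factorial * (j - 1).factorial *
      coeff (tripleExp s i (j - 1)) Q) = -(s.factorial * i.factorial * j.factorial) *
      (if j = 0 then 0 else -((κ + 1 - j) * coeff (tripleExp s i (j - 1)) Q)) := by
    have := t j
    split_ifs at this ⊢ with hs
    · simp [hs]
    · rw [← this]; ring
  rw [e0, e1, e2, ← h0, ← h1, ← h2]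
  linear_combination -(s.factorial * i.factorial * j.factorial : ℝ) * h

theorem coeff_aeval_line {G : ℕ} (hQ : Q.IsHomogeneous G) (n : ℕ) (hn : n ≤ G) :
    (aeval ![(1 : Polynomial ℝ), 0, Polynomial.X] Q).coeff n = coeff (tripleExp (G - n) 0 n) Q := by
  classical
  rw [aeval_def, eval₂_eq', Polynomial.finsetSum_coeff]
  rw [Finset.sum_eq_single (tripleExp (G - n) 0 n)]
  · simp [Fin.prod_univ_three]
  · intro m hm hne
    simp only [Fin.prod_univ_three, Matrix.cons_val_zero, Matrix.cons_val_one, Matrix.cons_val,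
      one_pow, one_mul, Polynomial.algebraMap_eq, Polynomial.coeff_C_mul]
    by_cases h1 : m 1 = 0
    · rw [h1, pow_zero, one_mul, Polynomial.coeff_X_pow, if_neg, mul_zero]
      intro h2
      apply hne
      have hd := hQ (mem_support_iff.1 hm)
      rw [Finsupp.weight_apply, Finsupp.sum_fintype _ _ (by simp), Fin.sum_univ_three] at hd
      simp at hd
      rw [eq_tripleExp m, h1, ← h2, show m 0 = G - n by omega]
    · simp [h1]
  · intro hm
    rw [notMem_support_iff] at hm
    simp [hm]

/-- The discriminant of three variables. -/
noncomputable def discForm : MvPolynomial (Fin 3) ℝ :=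
  ((X 0 - X 1) * (X 1 - X 2) * (X 2 - X 0)) ^ 2

/-- The translation-invariant symmetric form of degree two. -/
noncomputable def quadForm : MvPolynomial (Fin 3) ℝ :=
  (X 0 - X 1) ^ 2 + (X 1 - X 2) ^ 2 + (X 2 - X 0) ^ 2

/-- The translation-invariant symmetric form of degree three. -/
noncomputable def cubicForm : MvPolynomial (Fin 3) ℝ :=
  (X 0 + X 1 - X 2 - X 2) * (X 1 + X 2 - X 0 - X 0) * (X 2 + X 0 - X 1 - X 1)

/-- The monomials in the three basic invariants. -/
noncomputable def invariantForm (M p e : ℕ) : MvPolynomial (Fin 3) ℝ :=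
  discForm ^ M * quadForm ^ p * cubicForm ^ e

theorem rename_swap_left_invariantForm (M p e : ℕ) :
    rename (Equiv.swap 0 1) (invariantForm M p e) = invariantForm M p e := by
  have h2 : Equiv.swap (0 : Fin 3) 1 2 = 2 := by decide
  have hd : rename (Equiv.swap 0 1) discForm = discForm := by
    simp only [discForm, map_pow, map_mul, map_sub, rename_X, Equiv.swap_apply_left,
      Equiv.swap_apply_right, h2]
    ring
  have hq : rename (Equiv.swap 0 1) quadForm = quadForm := by
    simp only [quadForm, map_pow, map_add, map_sub, rename_X, Equiv.swap_apply_left,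
      Equiv.swap_apply_right, h2]
    ring
  have hc : rename (Equiv.swap 0 1) cubicForm = cubicForm := by
    simp only [cubicForm, map_mul, map_add, map_sub, rename_X, Equiv.swap_apply_left,
      Equiv.swap_apply_right, h2]
    ring
  simp only [invariantForm, map_mul, map_pow, hd, hq, hc]

theorem rename_swap_right_invariantForm (M p e : ℕ) :
    rename (Equiv.swap 1 2) (invariantForm M p e) = invariantForm M p e := by
  have h2 : Equiv.swap (1 : Fin 3) 2 0 = 0 := by decide
  have hd : rename (Equiv.swap 1 2) discForm = discForm := by
    simp only [discForm, map_pow, map_mul, map_sub, rename_X, Equiv.swap_apply_left,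
      Equiv.swap_apply_right, h2]
    ring
  have hq : rename (Equiv.swap 1 2) quadForm = quadForm := by
    simp only [quadForm, map_pow, map_add, map_sub, rename_X, Equiv.swap_apply_left,
      Equiv.swap_apply_right, h2]
    ring
  have hc : rename (Equiv.swap 1 2) cubicForm = cubicForm := by
    simp only [cubicForm, map_mul, map_add, map_sub, rename_X, Equiv.swap_apply_left,
      Equiv.swap_apply_right, h2]
    ring
  simp only [invariantForm, map_mul, map_pow, hd, hq, hc]

theorem isHomogeneous_invariantForm (M p e : ℕ) :
    (invariantForm M p e).IsHomogeneous (6 * M + 2 * p + 3 * e) := by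
  have hX : ∀ a : Fin 3, (X a : MvPolynomial (Fin 3) ℝ).IsHomogeneous 1 := isHomogeneous_X _
  have hd : discForm.IsHomogeneous 6 :=
    ((((hX 0).sub (hX 1)).mul ((hX 1).sub (hX 2))).mul ((hX 2).sub (hX 0))).pow 2
  have hq : quadForm.IsHomogeneous 2 :=
    ((((hX 0).sub (hX 1)).pow 2).add (((hX 1).sub (hX 2)).pow 2)).add (((hX 2).sub (hX 0)).pow 2)
  have hc : cubicForm.IsHomogeneous 3 :=
    (((((hX 0).add (hX 1)).sub (hX 2)).sub (hX 2)).mul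
      ((((hX 1).add (hX 2)).sub (hX 0)).sub (hX 0))).mul
      ((((hX 2).add (hX 0)).sub (hX 1)).sub (hX 1))
  exact ((hd.pow M).mul (hq.pow p)).mul (hc.pow e)

theorem degreeOf_invariantForm_le (M p e : ℕ) :
    (invariantForm M p e).degreeOf 0 ≤ 4 * M + 2 * p + 3 * e := by
  have hX : ∀ a : Fin 3, (X a : MvPolynomial (Fin 3) ℝ).degreeOf 0 ≤ 1 := fun a => by
    rw [degreeOf_X]; split_ifs <;> simp
  have hs : ∀ (n : ℕ) (f g : MvPolynomial (Fin 3) ℝ), f.degreeOf 0 ≤ n → g.degreeOf 0 ≤ n →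
      (f - g).degreeOf 0 ≤ n := fun n f g hf hg =>
    (degreeOf_sub_le 0 f g).trans (max_le hf hg)
  have ha : ∀ (n : ℕ) (f g : MvPolynomial (Fin 3) ℝ), f.degreeOf 0 ≤ n → g.degreeOf 0 ≤ n →
      (f + g).degreeOf 0 ≤ n := fun n f g hf hg =>
    (degreeOf_add_le 0 f g).trans (max_le hf hg)
  have hm : ∀ (n n' : ℕ) (f g : MvPolynomial (Fin 3) ℝ), f.degreeOf 0 ≤ n → g.degreeOf 0 ≤ n' →
      (f * g).degreeOf 0 ≤ n + n' := fun n n' f g hf hg =>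
    (degreeOf_mul_le 0 f g).trans (add_le_add hf hg)
  have hp : ∀ (n N : ℕ) (f : MvPolynomial (Fin 3) ℝ), f.degreeOf 0 ≤ n →
      (f ^ N).degreeOf 0 ≤ n * N := fun n N f hf =>
    (degreeOf_pow_le 0 f N).trans (by rw [mul_comm n]; exact Nat.mul_le_mul_left N hf)
  have h12 : (X 1 - X 2 : MvPolynomial (Fin 3) ℝ).degreeOf 0 ≤ 0 := by
    apply hs <;> rw [degreeOf_X] <;> decide
  have hd : discForm.degreeOf 0 ≤ 4 :=
    hp 2 2 _ (hm 1 1 _ _ (hm 1 0 _ _ (hs _ _ _ (hX _) (hX _)) h12) (hs _ _ _ (hX _) (hX _)))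
  have hq : quadForm.degreeOf 0 ≤ 2 :=
    ha _ _ _ (ha _ _ _ (hp 1 2 _ (hs _ _ _ (hX _) (hX _))) (hp 1 2 _ (hs _ _ _ (hX _) (hX _))))
      (hp 1 2 _ (hs _ _ _ (hX _) (hX _)))
  have hl : ∀ a b c : Fin 3, (X a + X b - X c - X c : MvPolynomial (Fin 3) ℝ).degreeOf 0 ≤ 1 :=
    fun a b c => hs _ _ _ (hs _ _ _ (ha _ _ _ (hX _) (hX _)) (hX _)) (hX _)
  have hc : cubicForm.degreeOf 0 ≤ 3 := hm 2 1 _ _ (hm 1 1 _ _ (hl _ _ _) (hl _ _ _)) (hl _ _ _)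
  exact hm _ _ _ _ (hm _ _ _ _ (hp _ _ _ hd) (hp _ _ _ hq)) (hp _ _ _ hc)

theorem pderiv_invariantForm (M p e : ℕ) :
    pderiv 0 (invariantForm M p e) + pderiv 1 (invariantForm M p e)
      + pderiv 2 (invariantForm M p e) = 0 := by
  let D : Derivation ℝ (MvPolynomial (Fin 3) ℝ) (MvPolynomial (Fin 3) ℝ) :=
    pderiv 0 + pderiv 1 + pderiv 2
  have hX : ∀ a : Fin 3, D (X a) = 1 := by
    intro a
    fin_cases a <;> simp [D, pderiv_X]
  have hmul : ∀ f g, D f = 0 → D g = 0 → D (f * g) = 0 := fun f g hf hg => by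
    rw [D.leibniz, hf, hg]; simp
  have hpow : ∀ (n : ℕ) f, D f = 0 → D (f ^ n) = 0 := fun n f hf => by
    rw [D.leibniz_pow, hf]; simp
  have hd : D discForm = 0 := by
    refine hpow _ _ (hmul _ _ (hmul _ _ ?_ ?_) ?_) <;> simp [hX]
  have hq : D quadForm = 0 := by
    unfold quadForm
    rw [map_add, map_add, hpow, hpow, hpow] <;> simp [hX]
  have hc : D cubicForm = 0 := by
    refine hmul _ _ (hmul _ _ ?_ ?_) ?_ <;> simp [hX]
  exact hmul _ _ (hmul _ _ (hpow _ _ hd) (hpow _ _ hq)) (hpow _ _ hc)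

/-- The derivation `D` with `D X_a = X_a²` multiplies `X_a - X_b` by `X_a + X_b`. Over the three
differences these factors add up to `2(X_0 + X_1 + X_2)`, and squaring doubles this. -/
theorem special_discForm_pow (M : ℕ) :
    X 0 * (X 0 * pderiv 0 (invariantForm M 0 0)) + X 1 * (X 1 * pderiv 1 (invariantForm M 0 0))
      + X 2 * (X 2 * pderiv 2 (invariantForm M 0 0))
      = C (4 * M : ℝ) * (X 0 * invariantForm M 0 0 + X 1 * invariantForm M 0 0
        + X 2 * invariantForm M 0 0) := by
  simp only [invariantForm, pow_zero, mul_one]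
  let D : Derivation ℝ (MvPolynomial (Fin 3) ℝ) (MvPolynomial (Fin 3) ℝ) :=
    (X 0 ^ 2 : MvPolynomial (Fin 3) ℝ) • pderiv 0 + (X 1 ^ 2 : MvPolynomial (Fin 3) ℝ) • pderiv 1
      + (X 2 ^ 2 : MvPolynomial (Fin 3) ℝ) • pderiv 2
  have hX : ∀ a : Fin 3, D (X a) = X a ^ 2 := by
    intro a
    fin_cases a <;> simp [D, pderiv_X]
  have hD : ∀ f, X 0 * (X 0 * pderiv 0 f) + X 1 * (X 1 * pderiv 1 f) + X 2 * (X 2 * pderiv 2 f)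
      = D f := by
    intro f
    simp only [D, Derivation.add_apply, Derivation.smul_apply, smul_eq_mul]
    ring
  have hd : D discForm = C 4 * (X 0 + X 1 + X 2) * discForm := by
    have h4 : (C 4 : MvPolynomial (Fin 3) ℝ) = 4 := map_ofNat C 4
    simp only [discForm, D.leibniz_pow, D.leibniz, map_sub, hX, smul_eq_mul, h4, nsmul_eq_mul]
    push_cast
    ring
  rw [hD]
  induction M with
  | zero => simp
  | succ M ih =>
    rw [pow_succ, D.leibniz, ih, hd]
    simp only [smul_eq_mul]
    push_cast
    rw [mul_add (4 : ℝ), mul_one, C_add]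
    ring

/-- On the line `T = 1, S = 0` the discriminant vanishes to order exactly two at `U = 0`, while the
other two invariants do not vanish there. The coefficient of `U^(2M)` is thus the lowest nonzero
one. -/
theorem coeff_invariantForm_ne_zero (M p e : ℕ) :
    coeff (tripleExp (4 * M + 2 * p + 3 * e) 0 (2 * M)) (invariantForm M p e) ≠ 0 := by
  have h := coeff_aeval_line (isHomogeneous_invariantForm M p e) (2 * M) (by omega)
  rw [show 6 * M + 2 * p + 3 * e - 2 * M = 4 * M + 2 * p + 3 * e by omega] at h
  rw [← h]
  have h2 : aeval ![(1 : Polynomial ℝ), 0, Polynomial.X] (invariantForm M p e) =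
      ((Polynomial.X - 1) ^ 2) ^ M * (1 + Polynomial.X ^ 2 + (Polynomial.X - 1) ^ 2) ^ p *
        ((1 - Polynomial.X - Polynomial.X) * (Polynomial.X - 1 - 1) * (Polynomial.X + 1)) ^ e
        * Polynomial.X ^ (2 * M) := by
    simp only [invariantForm, discForm, quadForm, cubicForm, map_mul, map_pow, map_sub, map_add,
      aeval_X, Matrix.cons_val_zero, Matrix.cons_val_one, Matrix.cons_val]
    rw [show (((1 - 0) * (0 - Polynomial.X) * (Polynomial.X - 1)) ^ 2 : Polynomial ℝ)
      = (Polynomial.X - 1) ^ 2 * Polynomial.X ^ 2 by ring, mul_pow _ (Polynomial.X ^ 2 : Polynomial ℝ),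
      ← pow_mul Polynomial.X]
    ring
  rw [h2, Polynomial.coeff_mul_X_pow', if_pos le_rfl, Nat.sub_self, Polynomial.coeff_zero_eq_eval_zero]
  simp
  norm_num

end Forms

/-! ### Counting the forms, and affine coordinates on bracket arrays. -/

theorem isTripleArray_invariantForm {k w M p e : ℕ} (hdeg : 4 * M + 2 * p + 3 * e < k)
    (hs : 2 * w = k + 1 → p = 0 ∧ e = 0 ∧ k = 4 * M + 1) :
    IsTripleArray k w (tripleCoeff (invariantForm M p e)) where
  swap_left := tripleCoeff_swap_left (rename_swap_left_invariantForm M p e)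
  swap_right := tripleCoeff_swap_right (rename_swap_right_invariantForm M p e)
  eq_zero_of_le s i j h :=
    tripleCoeff_eq_zero s i j ((degreeOf_invariantForm_le M p e).trans_lt (by omega))
  translation s i j _ := tripleCoeff_translation (pderiv_invariantForm M p e) s i j
  special hkw s i j _ := by
    obtain ⟨rfl, rfl, hk⟩ := hs hkw
    have h := tripleCoeff_special (4 * M) (special_discForm_pow M) s i j
    have hk' : (4 * M + 1 : ℝ) = k := by rw [hk]; push_cast; ring
    rwa [hk'] at h

open BigradedLieAlgebra

/-- The power `2M` of `U` is matched with the index `w + 2m`, and the total degree must be `w + k -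
2`. Since `w` is odd, the cubic invariant is needed once exactly for even `k`. The quadratic
exponent is then nonnegative precisely for `m ≤ d`, which is the origin of the floor in `paramDim`.
-/
theorem exists_exponents {k w d m : ℕ} (hw : Odd w) (hd : paramDim k w = d) (hm : m ≤ d) :
    ∃ M p e, 2 * M + 1 = w + 2 * m ∧ 6 * M + 2 * p + 3 * e + 2 = w + k ∧
      (2 * w = k + 1 → p = 0 ∧ e = 0 ∧ k = 4 * M + 1) := by
  obtain ⟨v, rfl⟩ := hw
  unfold paramDim at hd
  obtain ⟨l, rfl | rfl⟩ := k.even_or_odd'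
  · rw [if_neg (by simp)] at hd
    exact ⟨v + m, l - 2 * v - 2 - 3 * m, 1, by omega, by omega, by omega⟩
  · rw [if_pos (by simp)] at hd
    exact ⟨v + m, l - 2 * v - 3 * m, 0, by omega, by omega, by omega⟩

theorem paramDim_bound {k w D : ℕ} (hw : Odd w) (hd : paramDim k w < D) :
    w + k ≤ 3 * (w + 2 * D) - 2 ∨ w + k = 3 * (w + 2 * D) := by
  obtain ⟨v, rfl⟩ := hw
  unfold paramDim at hd
  obtain ⟨l, rfl | rfl⟩ := k.even_or_odd'
  · rw [if_neg (by simp)] at hd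
    omega
  · rw [if_pos (by simp)] at hd
    omega

/-- For the chosen monomial the degree in `T` is at most `k - 1 - 2m`, whereas the entry at `w +
2m'` uses the exponent `k - 1 - 2m'` of `T`. Earlier entries therefore vanish, and the entry at `m`
is the nonzero extremal coefficient. -/
theorem exists_triangular_array {k w d m : ℕ} (hw : Odd w) (hd : paramDim k w = d) (hm : m ≤ d) :
    ∃ h, IsTripleArray k w h ∧ (∀ m' < m, bracketArray k w h 0 (w + 2 * m') = 0) ∧
      bracketArray k w h 0 (w + 2 * m) ≠ 0 := by
  obtain ⟨M, p, e, h1, h2, h3⟩ := exists_exponents hw hd hm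
  refine ⟨_, isTripleArray_invariantForm (M := M) (p := p) (e := e) (by omega) h3,
    fun m' hm' => ?_, ?_⟩
  · rw [bracketArray_of_add_eq _ (s := k - 1 - 2 * m') (by omega),
      tripleCoeff_eq_zero _ _ _ ((degreeOf_invariantForm_le M p e).trans_lt (by omega)),
      tripleCoeff_eq_zero _ _ _ ((degreeOf_invariantForm_le M p e).trans_lt (by omega))]
    simp
  · rw [bracketArray_of_add_eq _ (s := 4 * M + 2 * p + 3 * e) (by omega)]
    have h4 := coeff_invariantForm_ne_zero M p e
    have h5 : ((w + 2 * m : ℕ) : ℝ) ≠ 0 := by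
      have : w + 2 * m ≠ 0 := by omega
      exact_mod_cast this
    have h6 : tripleCoeff (invariantForm M p e) (4 * M + 2 * p + 3 * e) 0 (w + 2 * m - 1) ≠ 0 := by
      rw [show w + 2 * m - 1 = 2 * M by omega, tripleCoeff]
      refine mul_ne_zero ?_ h4
      positivity
    rw [Nat.cast_zero, zero_mul, zero_sub]
    exact mul_ne_zero (by positivity) (neg_ne_zero.2 (mul_ne_zero h5 h6))

theorem exists_array_of_coord {k w d : ℕ} (hw : Odd w) (hd : paramDim k w = d) (c : ℕ → ℝ) :
    ∃ h, IsTripleArray k w h ∧ ∀ m ≤ d, bracketArray k w h 0 (w + 2 * m) = c m := by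
  suffices H : ∀ n ≤ d + 1, ∃ h, IsTripleArray k w h ∧
      ∀ m < n, bracketArray k w h 0 (w + 2 * m) = c m by
    obtain ⟨h, hh, hc⟩ := H (d + 1) le_rfl
    exact ⟨h, hh, fun m hm => hc m (by omega)⟩
  intro n
  induction n with
  | zero => exact fun _ => ⟨0, IsTripleArray.zero, by simp⟩
  | succ n ih =>
    intro hn
    obtain ⟨h, hh, hc⟩ := ih (by omega)
    obtain ⟨f, hf, hf0, hf1⟩ := exists_triangular_array hw hd (m := n) (by omega)
    refine ⟨_, hh.add_smul ((c n - bracketArray k w h 0 (w + 2 * n)) /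
      bracketArray k w f 0 (w + 2 * n)) hf, fun m hm => ?_⟩
    rw [bracketArray_add_smul]
    simp only [Pi.add_apply, Pi.smul_apply, smul_eq_mul]
    rcases Nat.lt_succ_iff_lt_or_eq.1 hm with hm | rfl
    · rw [hf0 m hm, hc m hm]; simp
    · field_simp; ring

/-- The bracket arrays with `α 0 w = 1` form an affine space with coordinates
`α 0 (w + 2)`, …, `α 0 (w + 2 d)`. -/
theorem exists_affine_parametrization {k w d : ℕ} (hw : Odd w) (hd : paramDim k w = d) :
    ∃ (α₀ : ℕ → ℕ → ℝ) (L : (Fin d → ℝ) →ₗ[ℝ] (ℕ → ℕ → ℝ)),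
      Function.Injective L ∧
      (∀ t, ∃ h, IsTripleArray k w h ∧ bracketArray k w h = α₀ + L t) ∧
      (∀ t, (α₀ + L t) 0 w = 1) ∧
      ∀ α, IsBracketArray k w α → α 0 w = 1 → ∃ t, α = α₀ + L t := by
  -- A basis dual to the coordinates: `h 0` becomes the base point, since coordinate `0` is
  -- normalized to `1`, and `h 1, …, h d` span the directions.
  have H : ∀ m : ℕ, ∃ h, IsTripleArray k w h ∧ ∀ m' ≤ d,
      bracketArray k w h 0 (w + 2 * m') = if m' = m then 1 else 0 :=
    fun m => exists_array_of_coord hw hd _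
  choose h hh hc using H
  have happ : ∀ t : Fin d → ℝ, ∀ m ≤ d, (bracketArray k w (h 0) +
      Fintype.linearCombination ℝ (fun m : Fin d => bracketArray k w (h (m + 1))) t) 0 (w + 2 * m)
      = (if m = 0 then 1 else 0) + ∑ a : Fin d, t a * (if m = a + 1 then 1 else 0) := by
    intro t m hm
    simp only [Fintype.linearCombination_apply, Pi.add_apply, Finset.sum_apply, Pi.smul_apply,
      smul_eq_mul]
    rw [hc 0 m hm]
    congr 1
    exact Finset.sum_congr rfl fun a _ => by rw [hc _ m hm]
  have happ' : ∀ (t : Fin d → ℝ) (m : Fin d), (bracketArray k w (h 0) +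
      Fintype.linearCombination ℝ (fun m : Fin d => bracketArray k w (h (m + 1))) t) 0
        (w + 2 * (m + 1)) = t m := by
    intro t m
    rw [happ t (m + 1) (by omega), if_neg (by omega), zero_add, Finset.sum_eq_single m]
    · simp
    · intro a _ ha
      rw [if_neg, mul_zero]
      intro hcon
      exact ha (Fin.ext (by omega))
    · simp
  have harr : ∀ t : Fin d → ℝ, ∃ h', IsTripleArray k w h' ∧ bracketArray k w h' =
      bracketArray k w (h 0) +
        Fintype.linearCombination ℝ (fun m : Fin d => bracketArray k w (h (m + 1))) t := by
    intro t
    refine ⟨_, (IsTripleArray.sum Finset.univ t (fun m : Fin d => h (m + 1))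
      fun m => hh _).add_smul 1 (hh 0), ?_⟩
    rw [bracketArray_add_smul, one_smul, bracketArray_sum, add_comm,
      Fintype.linearCombination_apply]
  have hone : ∀ t : Fin d → ℝ, (bracketArray k w (h 0) +
      Fintype.linearCombination ℝ (fun m : Fin d => bracketArray k w (h (m + 1))) t) 0 w = 1 := by
    intro t
    have := happ t 0 (by omega)
    simpa using this
  refine ⟨_, _, ?_, harr, hone, ?_⟩
  · intro t t' htt
    funext m
    rw [← happ' t m, ← happ' t' m, htt]
  · intro α hα hα1
    refine ⟨fun m => α 0 (w + 2 * (m + 1)), ?_⟩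
    obtain ⟨h', hh', he⟩ := harr fun m => α 0 (w + 2 * (m + 1))
    have hb := hh'.isBracketArray
    rw [he] at hb
    refine hα.ext_of_coord hb hw (d + 1) (paramDim_bound hw (by omega)) fun m hm => ?_
    rcases m with _ | m
    · rw [mul_zero, add_zero, hone, hα1]
    · rw [happ' _ (⟨m, by omega⟩ : Fin d)]

/-! ### The multiplication table of the model. -/

namespace BigradedLieAlgebra

section Table

open Finsupp (single)

variable {k w : ℕ}

/-- The coordinates of `x_j`, zero unless `j ≤ k`. -/
noncomputable def vecX (j : ℕ) : FrameIndex k w →₀ ℝ :=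
  if h : j < k + 1 then single (.x ⟨j, h⟩) 1 else 0

/-- The coordinates of `y_j`, zero unless `1 ≤ j ≤ k`. -/
noncomputable def vecY (j : ℕ) : FrameIndex k w →₀ ℝ :=
  if h : 1 ≤ j ∧ j ≤ k then single (.y ⟨j - 1, by omega⟩) 1 else 0

/-- The coordinates of `[x_i, y_j]`. -/
noncomputable def vecXY (i j : ℕ) : FrameIndex k w →₀ ℝ :=
  if i + j = k ∧ 1 ≤ j then single .z ((-1) ^ i)
  else if i + j = k + 1 ∧ 1 ≤ j then single .n (-((-1) ^ i * i)) else 0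

/-- The brackets of the elements of a frame in which
`[x_i, x_j] = α i j • y_{i + j - w + 1}`. -/
noncomputable def bracketTable (α : ℕ → ℕ → ℝ) :
    FrameIndex k w → FrameIndex k w → (FrameIndex k w →₀ ℝ)
  | .a, q => single q (-(q.bidegree.1 : ℝ))
  | p, .a => single p (p.bidegree.1 : ℝ)
  | .b, q => single q (-(q.bidegree.2 : ℝ))
  | p, .b => single p (p.bidegree.2 : ℝ)
  | .E, .x j => vecX (j + 1)
  | .x j, .E => -vecX (j + 1)
  | .E, .y j => vecY (j + 2)
  | .y j, .E => -vecY (j + 2)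
  | .E, .z => single .n 1
  | .z, .E => -single .n 1
  | .c _, .E => single .a (-2) + single .b (k : ℝ)
  | .E, .c _ => -(single .a (-2) + single .b (k : ℝ))
  | .c _, .x j => (j * (k + 1 - j) : ℝ) • vecX (j - 1)
  | .x j, .c _ => -((j * (k + 1 - j) : ℝ) • vecX (j - 1))
  | .c _, .y j => (j * (k - j) : ℝ) • vecY j
  | .y j, .c _ => -((j * (k - j) : ℝ) • vecY j)
  | .c _, .n => single .z 1
  | .n, .c _ => -single .z 1
  | .x i, .x j => α i j • vecY (i + j + 1 - w)
  | .x i, .y j => vecXY i (j + 1)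
  | .y j, .x i => -vecXY i (j + 1)
  | _, _ => 0

theorem single_x (j : Fin (k + 1)) : single (FrameIndex.x j : FrameIndex k w) (1 : ℝ) = vecX j := by
  rw [vecX, dif_pos j.2]

theorem single_y (j : Fin k) :
    single (FrameIndex.y j : FrameIndex k w) (1 : ℝ) = vecY (j + 1) := by
  rw [vecY, dif_pos ⟨by omega, by omega⟩]
  rfl

theorem vecX_of_lt {j : ℕ} (h : k < j) : (vecX j : FrameIndex k w →₀ ℝ) = 0 :=
  dif_neg (by omega)

theorem vecY_of_lt {j : ℕ} (h : k < j) : (vecY j : FrameIndex k w →₀ ℝ) = 0 :=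
  dif_neg (by omega)

theorem vecY_zero : (vecY 0 : FrameIndex k w →₀ ℝ) = 0 :=
  dif_neg (by omega)

theorem vecX_eq {j : ℕ} (h : j ≤ k) :
    (vecX j : FrameIndex k w →₀ ℝ) = single (.x ⟨j, by omega⟩) 1 :=
  dif_pos (by omega)

theorem vecY_eq {j : ℕ} (h : 1 ≤ j ∧ j ≤ k) :
    (vecY j : FrameIndex k w →₀ ℝ) = single (.y ⟨j - 1, by omega⟩) 1 :=
  dif_pos h

theorem bracketTable_antisymm {α : ℕ → ℕ → ℝ} (hα : IsBracketArray k w α) (p q : FrameIndex k w) :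
    bracketTable α p q = -bracketTable α q p := by
  cases p <;> cases q <;>
    simp [bracketTable, FrameIndex.bidegree]
  rename_i i j
  rw [hα.antisymm i j, add_comm (i : ℕ), neg_smul]

/-- The vectors of the given bi-degree. -/
def homogeneous (p : ℤ × ℤ) : Submodule ℝ (FrameIndex k w →₀ ℝ) :=
  Finsupp.supported ℝ ℝ {i | i.bidegree = p}

theorem single_mem_homogeneous {i : FrameIndex k w} {p : ℤ × ℤ} (h : i.bidegree = p) (c : ℝ) :
    single i c ∈ (homogeneous p : Submodule ℝ (FrameIndex k w →₀ ℝ)) :=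
  Finsupp.single_mem_supported ℝ c h

theorem vecX_mem_homogeneous {j : ℕ} {p : ℤ × ℤ} (h : (-(j : ℤ), (-1 : ℤ)) = p) :
    vecX j ∈ (homogeneous p : Submodule ℝ (FrameIndex k w →₀ ℝ)) := by
  unfold vecX
  split_ifs with h'
  · exact single_mem_homogeneous (by simpa [FrameIndex.bidegree] using h) _
  · exact zero_mem _

theorem vecY_mem_homogeneous {j : ℕ} {p : ℤ × ℤ} (h : (-((w : ℤ) + j - 1), (-2 : ℤ)) = p) :
    vecY j ∈ (homogeneous p : Submodule ℝ (FrameIndex k w →₀ ℝ)) := by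
  unfold vecY
  split_ifs with h'
  · refine single_mem_homogeneous ?_ _
    rw [← h]
    simp only [FrameIndex.bidegree, Prod.mk.injEq, and_true]
    omega
  · exact zero_mem _

theorem vecXY_mem_homogeneous {i j : ℕ} {p : ℤ × ℤ} (h : (-((w : ℤ) + i + j - 1), (-3 : ℤ)) = p) :
    vecXY i j ∈ (homogeneous p : Submodule ℝ (FrameIndex k w →₀ ℝ)) := by
  unfold vecXY
  split_ifs with h' h''
  · refine single_mem_homogeneous ?_ _
    rw [← h]
    simp only [FrameIndex.bidegree, Prod.mk.injEq, and_true]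
    omega
  · refine single_mem_homogeneous ?_ _
    rw [← h]
    simp only [FrameIndex.bidegree, Prod.mk.injEq, and_true]
    omega
  · exact zero_mem _

theorem bracketTable_mem_homogeneous {α : ℕ → ℕ → ℝ} (hα : IsBracketArray k w α)
    (p q : FrameIndex k w) : bracketTable α p q ∈
      (homogeneous (p.bidegree + q.bidegree) : Submodule ℝ (FrameIndex k w →₀ ℝ)) := by
  have sw : ∀ p q : FrameIndex k w, bracketTable α q p ∈
      (homogeneous (q.bidegree + p.bidegree) : Submodule ℝ (FrameIndex k w →₀ ℝ)) →
      bracketTable α p q ∈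
      (homogeneous (p.bidegree + q.bidegree) : Submodule ℝ (FrameIndex k w →₀ ℝ)) := by
    intro p q h
    rw [bracketTable_antisymm hα, add_comm]
    exact neg_mem h
  have za : ∀ p : ℤ × ℤ, FrameIndex.a.bidegree (k := k) (w := w) + p = p := fun p => by
    simp [FrameIndex.bidegree]
  have zb : ∀ p : ℤ × ℤ, FrameIndex.b.bidegree (k := k) (w := w) + p = p := fun p => by
    simp [FrameIndex.bidegree]
  cases p with
  | a =>
    rw [za, bracketTable]
    exact single_mem_homogeneous rfl _
  | b =>
    cases q
    case a => apply sw; rw [za, bracketTable]; exact single_mem_homogeneous rfl _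
    all_goals
      rw [zb]
      exact single_mem_homogeneous rfl _
  | E =>
    cases q with
    | a => apply sw; rw [za, bracketTable]; exact single_mem_homogeneous rfl _
    | b => apply sw; rw [zb]; exact single_mem_homogeneous rfl _
    | x j => exact vecX_mem_homogeneous (Prod.ext
        (by simp only [FrameIndex.bidegree, Prod.fst_add]; push_cast; ring) rfl)
    | y j => exact vecY_mem_homogeneous (Prod.ext
        (by simp only [FrameIndex.bidegree, Prod.fst_add]; push_cast; ring) rfl)
    | z => exact single_mem_homogeneous (by
        refine Prod.ext ?_ rfl
        simp only [FrameIndex.bidegree, Prod.fst_add]; ring) _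
    | c h =>
      exact neg_mem (add_mem (single_mem_homogeneous (by simp [FrameIndex.bidegree]) _)
        (single_mem_homogeneous (by simp [FrameIndex.bidegree]) _))
    | _ => exact zero_mem _
  | c h =>
    cases q with
    | a => apply sw; rw [za, bracketTable]; exact single_mem_homogeneous rfl _
    | b => apply sw; rw [zb]; exact single_mem_homogeneous rfl _
    | E =>
      exact add_mem (single_mem_homogeneous (by simp [FrameIndex.bidegree]) _)
        (single_mem_homogeneous (by simp [FrameIndex.bidegree]) _)
    | x j =>
      rw [bracketTable]
      obtain ⟨j, hj⟩ := j
      rcases j with _ | j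
      · simp
      · exact Submodule.smul_mem _ _ (vecX_mem_homogeneous
          (Prod.ext
        (by simp only [FrameIndex.bidegree, Prod.fst_add]; push_cast; ring) rfl))
    | y j =>
      exact Submodule.smul_mem _ _ (vecY_mem_homogeneous
          (Prod.ext
        (by simp only [FrameIndex.bidegree, Prod.fst_add]; ring) rfl))
    | n => exact single_mem_homogeneous (by
        refine Prod.ext ?_ rfl
        simp only [FrameIndex.bidegree, Prod.fst_add]; ring) _
    | _ => exact zero_mem _
  | x i =>
    cases q with
    | a => apply sw; rw [za, bracketTable]; exact single_mem_homogeneous rfl _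
    | b => apply sw; rw [zb]; exact single_mem_homogeneous rfl _
    | E =>
      exact neg_mem (vecX_mem_homogeneous (Prod.ext
        (by simp only [FrameIndex.bidegree, Prod.fst_add]; push_cast; ring) rfl))
    | c h =>
      apply sw
      rw [bracketTable]
      obtain ⟨j, hj⟩ := i
      rcases j with _ | j
      · simp
      · exact Submodule.smul_mem _ _ (vecX_mem_homogeneous
          (Prod.ext
        (by simp only [FrameIndex.bidegree, Prod.fst_add]; push_cast; ring) rfl))
    | x j =>
      rw [bracketTable]
      by_cases hij : (i : ℕ) + j < w
      · rw [hα.eq_zero_of_add_lt _ _ hij, zero_smul]; exact zero_mem _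
      · refine Submodule.smul_mem _ _ (vecY_mem_homogeneous (Prod.ext ?_ rfl))
        simp only [FrameIndex.bidegree, Prod.fst_add]
        omega
    | y j => exact vecXY_mem_homogeneous (Prod.ext
        (by simp only [FrameIndex.bidegree, Prod.fst_add]; push_cast; ring) rfl)
    | _ => exact zero_mem _
  | y i =>
    cases q with
    | a => apply sw; rw [za, bracketTable]; exact single_mem_homogeneous rfl _
    | b => apply sw; rw [zb]; exact single_mem_homogeneous rfl _
    | E =>
      exact neg_mem (vecY_mem_homogeneous (Prod.ext
        (by simp only [FrameIndex.bidegree, Prod.fst_add]; push_cast; ring) rfl))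
    | c h =>
      exact neg_mem (Submodule.smul_mem _ _ (vecY_mem_homogeneous
          (Prod.ext
        (by simp only [FrameIndex.bidegree, Prod.fst_add]; ring) rfl)))
    | x j =>
      exact neg_mem (vecXY_mem_homogeneous (Prod.ext
        (by simp only [FrameIndex.bidegree, Prod.fst_add]; push_cast; ring) rfl))
    | _ => exact zero_mem _
  | z =>
    cases q with
    | a => apply sw; rw [za, bracketTable]; exact single_mem_homogeneous rfl _
    | b => apply sw; rw [zb]; exact single_mem_homogeneous rfl _
    | E =>
      apply sw
      exact single_mem_homogeneous (by
        refine Prod.ext ?_ rfl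
        simp only [FrameIndex.bidegree, Prod.fst_add]; ring) _
    | _ => exact zero_mem _
  | n =>
    cases q with
    | a => apply sw; rw [za, bracketTable]; exact single_mem_homogeneous rfl _
    | b => apply sw; rw [zb]; exact single_mem_homogeneous rfl _
    | c h =>
      apply sw
      exact single_mem_homogeneous (by
        refine Prod.ext ?_ rfl
        simp only [FrameIndex.bidegree, Prod.fst_add]; ring) _
    | _ => exact zero_mem _

/-- The bilinear extension of the bracket table. -/
noncomputable def bracketForm (α : ℕ → ℕ → ℝ) :
    (FrameIndex k w →₀ ℝ) →ₗ[ℝ] (FrameIndex k w →₀ ℝ) →ₗ[ℝ] (FrameIndex k w →₀ ℝ) :=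
  Finsupp.linearCombination ℝ fun p => Finsupp.linearCombination ℝ (bracketTable α p)

theorem bracketForm_single (α : ℕ → ℕ → ℝ) (p q : FrameIndex k w) :
    bracketForm α (single p 1) (single q 1) = bracketTable α p q := by
  simp [bracketForm]

theorem bracketForm_single_smul (α : ℕ → ℕ → ℝ) (p q : FrameIndex k w) (c : ℝ) :
    bracketForm α (single p 1) (single q c) = c • bracketTable α p q := by
  simp [bracketForm]

theorem bracketForm_antisymm {α : ℕ → ℕ → ℝ} (hα : IsBracketArray k w α)
    (u v : FrameIndex k w →₀ ℝ) : bracketForm α u v = -bracketForm α v u := by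
  have h : bracketForm (k := k) (w := w) α + (bracketForm (k := k) (w := w) α).flip = 0 := by
    ext p q : 4
    simp only [LinearMap.coe_comp, Function.comp_apply, Finsupp.lsingle_apply, LinearMap.add_apply,
      LinearMap.flip_apply, bracketForm_single, LinearMap.zero_apply]
    rw [bracketTable_antisymm hα, neg_add_cancel]
  exact eq_neg_of_add_eq_zero_left (LinearMap.congr_fun₂ h u v)

end Table

end BigradedLieAlgebra

/-! ### The Jacobi identity for the table. -/

namespace BigradedLieAlgebra

section Jacobi

open Finsupp (single)

variable {k w : ℕ} {α : ℕ → ℕ → ℝ}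

theorem bracketForm_E_X (j : ℕ) :
    bracketForm α (single (.E : FrameIndex k w) 1) (vecX j) = vecX (j + 1) := by
  by_cases h : j ≤ k
  · rw [vecX_eq h, bracketForm_single, bracketTable]
  · rw [vecX_of_lt (by omega), vecX_of_lt (by omega), map_zero]

theorem bracketForm_E_Y {j : ℕ} (hj : 1 ≤ j) :
    bracketForm α (single (.E : FrameIndex k w) 1) (vecY j) = vecY (j + 1) := by
  by_cases h : j ≤ k
  · rw [vecY_eq ⟨hj, h⟩, bracketForm_single, bracketTable]
    congr 1
    simp only
    omega
  · rw [vecY_of_lt (by omega), vecY_of_lt (by omega), map_zero]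

theorem bracketForm_c_X (hc : 2 * w = k + 1) (j : ℕ) :
    bracketForm α (single (.c hc : FrameIndex k w) 1) (vecX j) =
      (j * (k + 1 - j) : ℝ) • vecX (j - 1) := by
  by_cases h : j ≤ k
  · rw [vecX_eq h, bracketForm_single, bracketTable]
  · rw [vecX_of_lt (by omega), map_zero]
    rcases eq_or_ne j (k + 1) with rfl | h1
    · simp
    · rw [vecX_of_lt (by omega), smul_zero]

theorem bracketForm_c_Y (hc : 2 * w = k + 1) (j : ℕ) :
    bracketForm α (single (.c hc : FrameIndex k w) 1) (vecY j) =
      ((j - 1) * (k + 1 - j) : ℝ) • vecY (j - 1) := by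
  by_cases h : 1 ≤ j ∧ j ≤ k
  · rw [vecY_eq h, bracketForm_single, bracketTable]
    congr 1
    simp only
    rw [Nat.cast_sub h.1]
    push_cast
    ring
  · rcases j with _ | j
    · simp [vecY_zero]
    · rw [vecY_of_lt (by omega), map_zero]
      rcases eq_or_ne j k with rfl | h1
      · simp
      · rw [vecY_of_lt (by omega), smul_zero]

theorem bracketForm_X_X (hα : IsBracketArray k w α) (i j : ℕ) :
    bracketForm α (vecX i : FrameIndex k w →₀ ℝ) (vecX j) = α i j • vecY (i + j + 1 - w) := by
  by_cases hi : i ≤ k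
  · by_cases hj : j ≤ k
    · rw [vecX_eq hi, vecX_eq hj, bracketForm_single, bracketTable]
    · rw [vecX_of_lt (j := j) (by omega), map_zero, hα.antisymm, hα.eq_zero_of_lt _ _ (by omega),
        neg_zero, zero_smul]
  · rw [vecX_of_lt (j := i) (by omega), map_zero, LinearMap.zero_apply,
      hα.eq_zero_of_lt _ _ (by omega), zero_smul]

theorem bracketForm_X_Y (i j : ℕ) :
    bracketForm α (vecX i : FrameIndex k w →₀ ℝ) (vecY j) = vecXY i j := by
  by_cases hi : i ≤ k
  · by_cases hj : 1 ≤ j ∧ j ≤ k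
    · rw [vecX_eq hi, vecY_eq hj, bracketForm_single, bracketTable]
      simp only
      rw [Nat.sub_add_cancel hj.1]
    · rcases j with _ | j
      · simp [vecY_zero, vecXY]
      · rw [vecY_of_lt (by omega), map_zero, vecXY, if_neg (by omega)]
        split_ifs with h
        · rw [show i = 0 by omega]; simp
        · rfl
  · rw [vecX_of_lt (by omega), map_zero, LinearMap.zero_apply, vecXY, if_neg (by omega),
      if_neg (by omega)]

/-- The frame has no element whose second degree is below `-3`, so only few types of triples need to
be checked for Jacobi. -/
theorem bracketForm_eq_zero_of_lt (hα : IsBracketArray k w α) {p : FrameIndex k w}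
    {u : FrameIndex k w →₀ ℝ} {m : ℤ × ℤ} (hu : u ∈ homogeneous m)
    (hm : p.bidegree.2 + m.2 < -3) : bracketForm α (single p 1) u = 0 := by
  have h : ∀ q ∈ u.support, bracketTable α p q = 0 := by
    intro q hq
    have hq2 : q.bidegree = m := hu hq
    have h3 := bracketTable_mem_homogeneous hα p q
    have h4 : ∀ r : FrameIndex k w, r.bidegree ≠ p.bidegree + q.bidegree := by
      intro r hr
      have h5 := congrArg Prod.snd hr
      rw [Prod.snd_add, hq2] at h5
      have : (-3 : ℤ) ≤ r.bidegree.2 := by cases r <;> simp [FrameIndex.bidegree]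
      omega
    ext r
    by_contra hr
    exact h4 r (h3 (Finsupp.mem_support_iff.2 hr))
  simp only [bracketForm, Finsupp.linearCombination_single, one_smul]
  rw [Finsupp.linearCombination_apply, Finsupp.sum]
  exact Finset.sum_eq_zero fun q hq => by rw [h q hq, smul_zero]

/-- The cyclic sum in the Jacobi identity. -/
noncomputable def jacobiator (α : ℕ → ℕ → ℝ) (u v t : FrameIndex k w →₀ ℝ) :
    FrameIndex k w →₀ ℝ :=
  bracketForm α u (bracketForm α v t) + bracketForm α v (bracketForm α t u)
    + bracketForm α t (bracketForm α u v)

theorem jacobiator_rotate (u v t : FrameIndex k w →₀ ℝ) :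
    jacobiator α v t u = jacobiator α u v t := by
  simp only [jacobiator]; abel

theorem jacobiator_swap (hα : IsBracketArray k w α) (u v t : FrameIndex k w →₀ ℝ) :
    jacobiator α v u t = -jacobiator α u v t := by
  simp only [jacobiator]
  rw [bracketForm_antisymm hα u t, bracketForm_antisymm hα t v, bracketForm_antisymm hα v u]
  simp only [map_neg]
  abel

theorem bracketForm_a (u : FrameIndex k w →₀ ℝ) {m : ℤ × ℤ} (hu : u ∈ homogeneous m) :
    bracketForm α (single .a 1) u = (-(m.1 : ℝ)) • u := by
  simp only [bracketForm, Finsupp.linearCombination_single, one_smul]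
  rw [Finsupp.linearCombination_apply]
  conv_rhs => rw [← Finsupp.sum_single u, Finsupp.smul_sum]
  refine Finset.sum_congr rfl fun q hq => ?_
  have hq2 : q.bidegree = m := hu hq
  change u q • bracketTable α .a q = (-(m.1 : ℝ)) • single q (u q)
  rw [bracketTable, hq2, Finsupp.smul_single, Finsupp.smul_single, smul_eq_mul, smul_eq_mul,
    mul_comm]

theorem bracketTable_b (q : FrameIndex k w) :
    bracketTable α .b q = single q (-(q.bidegree.2 : ℝ)) := by
  cases q <;> simp [bracketTable, FrameIndex.bidegree]

theorem bracketForm_b (u : FrameIndex k w →₀ ℝ) {m : ℤ × ℤ} (hu : u ∈ homogeneous m) :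
    bracketForm α (single .b 1) u = (-(m.2 : ℝ)) • u := by
  simp only [bracketForm, Finsupp.linearCombination_single, one_smul]
  rw [Finsupp.linearCombination_apply]
  conv_rhs => rw [← Finsupp.sum_single u, Finsupp.smul_sum]
  refine Finset.sum_congr rfl fun q hq => ?_
  have hq2 : q.bidegree = m := hu hq
  change u q • bracketTable α .b q = (-(m.2 : ℝ)) • single q (u q)
  rw [bracketTable_b, hq2, Finsupp.smul_single, Finsupp.smul_single, smul_eq_mul, smul_eq_mul,
    mul_comm]

/-- Since `a` acts on bi-degree `m` as the scalar `-m.1`, this is just additivity of the first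
degree under brackets. -/
theorem jacobiator_a (hα : IsBracketArray k w α) (p q : FrameIndex k w) :
    jacobiator α (single .a 1) (single p 1) (single q 1) = 0 := by
  rw [jacobiator, bracketForm_antisymm hα (single q 1) (single .a 1), bracketForm_single α p q,
    bracketForm_a _ (bracketTable_mem_homogeneous hα p q),
    bracketForm_a _ (single_mem_homogeneous rfl 1), bracketForm_a _ (single_mem_homogeneous rfl 1),
    map_neg, map_smul, map_smul, bracketForm_single, bracketForm_single,
    bracketTable_antisymm hα q p, Prod.fst_add]
  push_cast
  module

theorem jacobiator_b (hα : IsBracketArray k w α) (p q : FrameIndex k w) :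
    jacobiator α (single .b 1) (single p 1) (single q 1) = 0 := by
  rw [jacobiator, bracketForm_antisymm hα (single q 1) (single .b 1), bracketForm_single α p q,
    bracketForm_b _ (bracketTable_mem_homogeneous hα p q),
    bracketForm_b _ (single_mem_homogeneous rfl 1), bracketForm_b _ (single_mem_homogeneous rfl 1),
    map_neg, map_smul, map_smul, bracketForm_single, bracketForm_single,
    bracketTable_antisymm hα q p, Prod.snd_add]
  push_cast
  module

theorem jacobiator_E_X_X (hα : IsBracketArray k w α) (i j : ℕ) :
    jacobiator α (single (.E : FrameIndex k w) 1) (vecX i) (vecX j) = 0 := by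
  rw [jacobiator, bracketForm_antisymm hα (vecX j) (single .E 1), bracketForm_E_X, bracketForm_E_X,
    map_neg, bracketForm_X_X hα, bracketForm_X_X hα, bracketForm_X_X hα, map_smul,
    hα.antisymm j (i + 1), show i + (j + 1) + 1 - w = i + j + 2 - w by omega,
    show j + (i + 1) + 1 - w = i + j + 2 - w by omega]
  by_cases h1 : i + j + 1 < w
  · rw [hα.eq_zero_of_add_lt i j (by omega), hα.eq_zero_of_add_lt i (j + 1) (by omega),
      hα.eq_zero_of_add_lt (i + 1) j (by omega)]
    simp
  by_cases h2 : w + k ≤ i + j + 1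
  · rw [vecY_of_lt (j := i + j + 2 - w) (by omega)]
    rcases Nat.eq_zero_or_pos (i + j + 1 - w) with h3 | h3
    · simp [h3, vecY_zero]
    · rw [bracketForm_E_Y h3, vecY_of_lt (by omega)]
      simp
  have hs := hα.step i j (by omega)
  -- At this boundary the bracket of `x_i` and `x_j` would be a multiple of `y_0 = 0`, while `ad E`
  -- sends no such `y_0` to `y_1`. The step relation itself supplies the cancellation.
  by_cases h3 : i + j + 1 = w
  · have h0 := hα.eq_zero_of_add_lt i j (by omega)
    rw [h0] at hs ⊢
    rw [zero_smul, zero_add, ← neg_smul, ← add_smul,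
      show -α i (j + 1) + -α (i + 1) j = 0 by linarith, zero_smul]
  · rw [bracketForm_E_Y (by omega), show i + j + 1 - w + 1 = i + j + 2 - w by omega, ← hs]
    module

theorem jacobiator_E_X_Y (hα : IsBracketArray k w α) (i : ℕ) {j : ℕ} (hj : 1 ≤ j) :
    jacobiator α (single (.E : FrameIndex k w) 1) (vecX i) (vecY j) = 0 := by
  have hz : bracketForm α (single (.E : FrameIndex k w) 1) (single .z 1) = single .n 1 := by
    rw [bracketForm_single]; rfl
  have hn : bracketForm α (single (.E : FrameIndex k w) 1) (single .n 1) = 0 := by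
    rw [bracketForm_single]; rfl
  have hz' : ∀ c : ℝ, bracketForm α (single (.E : FrameIndex k w) 1) (single .z c)
      = single .n c := fun c => by
    rw [← mul_one c, ← smul_eq_mul, ← Finsupp.smul_single, map_smul, hz, Finsupp.smul_single]
  have hn' : ∀ c : ℝ, bracketForm α (single (.E : FrameIndex k w) 1) (single .n c) = 0 := fun c => by
    rw [← mul_one c, ← smul_eq_mul, ← Finsupp.smul_single, map_smul, hn, smul_zero]
  rw [jacobiator, bracketForm_antisymm hα (vecY j) (single .E 1), bracketForm_E_X,
    bracketForm_E_Y hj, map_neg, bracketForm_X_Y, bracketForm_X_Y,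
    bracketForm_antisymm hα (vecY j), bracketForm_X_Y]
  rcases lt_trichotomy (i + j) k with h | h | h
  · by_cases h2 : i + j + 1 = k
    · rw [vecXY, if_neg (by omega), if_neg (by omega), vecXY, if_pos (by omega), vecXY,
        if_pos (by omega), pow_succ]
      simp
    · rw [vecXY, if_neg (by omega), if_neg (by omega), vecXY, if_neg (by omega), if_neg (by omega),
        vecXY, if_neg (by omega), if_neg (by omega)]
      simp
  · rw [vecXY, if_pos (by omega), vecXY, if_neg (by omega), if_pos (by omega), vecXY,
      if_neg (by omega), if_pos (by omega), hz', ← Finsupp.single_neg, ← Finsupp.single_neg,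
      ← Finsupp.single_add, ← Finsupp.single_add, Finsupp.single_eq_zero, pow_succ]
    push_cast
    ring
  · have h1 : (vecXY i (j + 1) : FrameIndex k w →₀ ℝ) = 0 := by
      rw [vecXY, if_neg (by omega), if_neg (by omega)]
    have h2 : (vecXY (i + 1) j : FrameIndex k w →₀ ℝ) = 0 := by
      rw [vecXY, if_neg (by omega), if_neg (by omega)]
    rw [h1, h2, vecXY, if_neg (by omega)]
    split_ifs <;> simp [hn', -Finsupp.single_neg, -Finsupp.single_mul]

/-- Separates the `z`- and `n`-components by the value of `i + j + l`. For `j + l < w` the index `j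
+ l + 1 - w` is truncated, and only the vanishing of `α j l` saves the formula. -/
theorem smul_vecXY (hα : ∀ i j, i + j < w → α i j = 0) (i j l : ℕ) :
    α j l • (vecXY i (j + l + 1 - w) : FrameIndex k w →₀ ℝ) =
      (if i + j + l + 1 = w + k then single .z ((-1) ^ i * α j l) else 0)
      - (if i + j + l = w + k then single .n ((-1) ^ i * i * α j l) else 0) := by
  by_cases h : j + l < w
  · rw [hα _ _ h]
    simp
  · by_cases h1 : i + j + l + 1 = w + k
    · rw [vecXY, if_pos (by omega), if_pos h1, if_neg (by omega), Finsupp.smul_single, smul_eq_mul,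
        mul_comm, sub_zero]
    · by_cases h2 : i + j + l = w + k
      · rw [vecXY, if_neg (by omega), if_pos (by omega), if_neg h1, if_pos h2, Finsupp.smul_single,
          smul_eq_mul, zero_sub, ← Finsupp.single_neg]
        congr 1
        ring
      · rw [vecXY, if_neg (by omega), if_neg (by omega), if_neg h1, if_neg h2]
        simp

theorem jacobiator_X_X_X (hα : IsBracketArray k w α)
    (hz : ∀ i j l, i + j + l + 1 = w + k →
      (-1) ^ i * α j l + (-1) ^ j * α l i + (-1) ^ l * α i j = 0)
    (hn : ∀ i j l : ℕ, i + j + l = w + k →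
      (-1) ^ i * i * α j l + (-1) ^ j * j * α l i + (-1) ^ l * l * α i j = 0) (i j l : ℕ) :
    jacobiator α (vecX i : FrameIndex k w →₀ ℝ) (vecX j) (vecX l) = 0 := by
  simp only [jacobiator, bracketForm_X_X hα, map_smul, bracketForm_X_Y]
  simp only [smul_vecXY hα.eq_zero_of_add_lt]
  by_cases h1 : i + j + l + 1 = w + k
  · rw [if_pos h1, if_neg (by omega), if_pos (by omega), if_neg (by omega), if_pos (by omega),
      if_neg (by omega), sub_zero, sub_zero, sub_zero, ← Finsupp.single_add, ← Finsupp.single_add,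
      hz i j l h1, Finsupp.single_zero]
  · by_cases h2 : i + j + l = w + k
    · rw [if_neg h1, if_pos h2, if_neg (by omega), if_pos (by omega), if_neg (by omega),
        if_pos (by omega), zero_sub, zero_sub, zero_sub, ← neg_add, ← neg_add,
        ← Finsupp.single_add, ← Finsupp.single_add, hn i j l h2, Finsupp.single_zero, neg_zero]
    · rw [if_neg h1, if_neg h2, if_neg (by omega), if_neg (by omega), if_neg (by omega),
        if_neg (by omega)]
      simp

theorem bracketForm_c_E (hc : 2 * w = k + 1) :
    bracketForm α (single (.c hc : FrameIndex k w) 1) (single .E 1)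
      = (-2 : ℝ) • single .a 1 + (k : ℝ) • single .b 1 := by
  rw [bracketForm_single, bracketTable]
  simp

/-- The Jacobi identity for `E`, `c` and a homogeneous vector. -/
theorem jacobiator_E_c (hα : IsBracketArray k w α) (hc : 2 * w = k + 1) (u : FrameIndex k w →₀ ℝ)
    {m : ℤ × ℤ} (hu : u ∈ homogeneous m) {r s : ℝ}
    (h1 : bracketForm α (single .E 1) (bracketForm α (single (.c hc) 1) u) = r • u)
    (h2 : bracketForm α (single (.c hc) 1) (bracketForm α (single .E 1) u) = s • u)
    (h : r - s + 2 * m.1 - k * m.2 = 0) :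
    jacobiator α (single .E 1) (single (.c hc) 1) u = 0 := by
  rw [jacobiator, bracketForm_antisymm hα u (single .E 1), map_neg, h1, h2,
    bracketForm_antisymm hα (single .E 1) (single (.c hc) 1), map_neg, bracketForm_antisymm hα u,
    bracketForm_c_E, map_add, map_smul, map_smul, LinearMap.add_apply, LinearMap.smul_apply,
    LinearMap.smul_apply, bracketForm_a u hu, bracketForm_b u hu, neg_neg]
  have h' : r = s - 2 * m.1 + k * m.2 := by linarith
  rw [h']
  module

theorem jacobiator_E_c_X (hα : IsBracketArray k w α) (hc : 2 * w = k + 1) (j : ℕ) :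
    jacobiator α (single (.E : FrameIndex k w) 1) (single (.c hc) 1) (vecX j) = 0 := by
  refine jacobiator_E_c hα hc _ (vecX_mem_homogeneous rfl) (r := j * (k + 1 - j))
    (s := (j + 1) * (k - j)) ?_ ?_ ?_
  · rw [bracketForm_c_X, map_smul, bracketForm_E_X]
    rcases j with _ | j
    · simp
    · rfl
  · rw [bracketForm_E_X, bracketForm_c_X, Nat.add_sub_cancel]
    congr 1
    push_cast
    ring
  · push_cast
    ring

/-- The two coefficients and the action of `[c, E] = -2a + kb` differ by `k + 1 - 2w`. This is where
the special value of `w` enters: it makes the weight of `y_1` equal to `k - 1`, as befits an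
irreducible module of dimension `k`. -/
theorem jacobiator_E_c_Y (hα : IsBracketArray k w α) (hc : 2 * w = k + 1) {j : ℕ} (hj : 1 ≤ j) :
    jacobiator α (single (.E : FrameIndex k w) 1) (single (.c hc) 1) (vecY j) = 0 := by
  refine jacobiator_E_c hα hc _ (vecY_mem_homogeneous rfl) (r := (j - 1) * (k + 1 - j))
    (s := j * (k - j)) ?_ ?_ ?_
  · rw [bracketForm_c_Y, map_smul]
    rcases j with _ | _ | j
    · omega
    · simp
    · rw [bracketForm_E_Y (by omega)]
      rfl
  · rw [bracketForm_E_Y hj, bracketForm_c_Y, Nat.add_sub_cancel]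
    congr 1
    push_cast
    ring
  · have hc' : (2 * w : ℝ) = k + 1 := by exact_mod_cast hc
    push_cast
    linear_combination -hc'

theorem jacobiator_E_c_z (hα : IsBracketArray k w α) (hc : 2 * w = k + 1) :
    jacobiator α (single (.E : FrameIndex k w) 1) (single (.c hc) 1) (single .z 1) = 0 := by
  refine jacobiator_E_c hα hc _ (single_mem_homogeneous rfl _) (r := 0) (s := 1) ?_ ?_ ?_
  · rw [bracketForm_single, bracketTable, map_zero, zero_smul]
    all_goals simp
  · rw [bracketForm_single, bracketTable, bracketForm_single, bracketTable, one_smul]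
  · have hc' : (2 * w : ℝ) = k + 1 := by exact_mod_cast hc
    simp only [FrameIndex.bidegree]
    push_cast
    linear_combination -hc'

theorem jacobiator_E_c_n (hα : IsBracketArray k w α) (hc : 2 * w = k + 1) :
    jacobiator α (single (.E : FrameIndex k w) 1) (single (.c hc) 1) (single .n 1) = 0 := by
  refine jacobiator_E_c hα hc _ (single_mem_homogeneous rfl _) (r := 1) (s := 0) ?_ ?_ ?_
  · rw [bracketForm_single, bracketTable, bracketForm_single, bracketTable, one_smul]
  · rw [bracketForm_single, bracketTable, map_zero, zero_smul]
    all_goals simp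
  · have hc' : (2 * w : ℝ) = k + 1 := by exact_mod_cast hc
    simp only [FrameIndex.bidegree]
    push_cast
    linear_combination -hc'

theorem jacobiator_c_X_X (hα : IsBracketArray k w α) (hc : 2 * w = k + 1)
    (hs : ∀ i j : ℕ, (i : ℝ) * (k + 1 - i) * α (i - 1) j + j * (k + 1 - j) * α i (j - 1)
      = (i + j - w) * (w + k - i - j) * α i j) (i j : ℕ) :
    jacobiator α (single (.c hc : FrameIndex k w) 1) (vecX i) (vecX j) = 0 := by
  rw [jacobiator, bracketForm_antisymm hα (vecX j) (single (.c hc) 1), bracketForm_c_X,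
    bracketForm_c_X, map_neg, map_smul, map_smul, bracketForm_X_X hα, bracketForm_X_X hα,
    bracketForm_X_X hα, map_smul, bracketForm_c_Y, hα.antisymm j (i - 1)]
  have e1 : ((j : ℝ) * (k + 1 - j)) • α i (j - 1) •
      (vecY (i + (j - 1) + 1 - w) : FrameIndex k w →₀ ℝ) =
      ((j : ℝ) * (k + 1 - j) * α i (j - 1)) • vecY (i + j - w) := by
    rcases j with _ | j
    · simp
    · rw [smul_smul]; rfl
  have e2 : ((i : ℝ) * (k + 1 - i)) • (-α (i - 1) j) •
      (vecY (j + (i - 1) + 1 - w) : FrameIndex k w →₀ ℝ) =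
      -((i : ℝ) * (k + 1 - i) * α (i - 1) j) • vecY (i + j - w) := by
    rcases i with _ | i
    · simp
    · rw [smul_smul, show j + (i + 1 - 1) + 1 - w = i + 1 + j - w by omega, mul_neg]
  have e3 : α i j • ((((i + j + 1 - w : ℕ) : ℝ) - 1) * (k + 1 - ((i + j + 1 - w : ℕ) : ℝ))) •
      (vecY (i + j + 1 - w - 1) : FrameIndex k w →₀ ℝ) =
      ((i + j - w) * (w + k - i - j) * α i j : ℝ) • vecY (i + j - w) := by
    by_cases h : i + j < w
    · rw [hα.eq_zero_of_add_lt _ _ h]; simp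
    · rw [smul_smul, show i + j + 1 - w - 1 = i + j - w by omega, Nat.cast_sub (by omega)]
      congr 1
      push_cast
      ring
  rw [e1, e2, e3, ← hs i j]
  module

theorem jacobiator_c_X_Y (hα : IsBracketArray k w α) (hc : 2 * w = k + 1) (i : ℕ) {j : ℕ}
    (hj : 1 ≤ j) :
    jacobiator α (single (.c hc : FrameIndex k w) 1) (vecX i) (vecY j) = 0 := by
  have hz' : ∀ c : ℝ, bracketForm α (single (.c hc : FrameIndex k w) 1) (single .z c) = 0 :=
    fun c => by
      rw [bracketForm_single_smul]; simp [bracketTable]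
  have hn' : ∀ c : ℝ, bracketForm α (single (.c hc : FrameIndex k w) 1) (single .n c)
      = single .z c := fun c => by
      rw [bracketForm_single_smul]; simp [bracketTable]
  rw [jacobiator, bracketForm_antisymm hα (vecY j) (single (.c hc) 1), bracketForm_c_X,
    bracketForm_c_Y, map_neg, map_smul, map_smul, bracketForm_X_Y, bracketForm_X_Y,
    bracketForm_antisymm hα (vecY j), bracketForm_X_Y]
  rcases i with _ | i
  · have h0 : bracketForm α (single (.c hc : FrameIndex k w) 1) (vecXY 0 j) = 0 := by
      unfold vecXY
      split_ifs
      · exact hz' _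
      · rw [hn']; simp
      · simp
    have h1 : ((j - 1 : ℝ) * (k + 1 - j)) • (vecXY 0 (j - 1) : FrameIndex k w →₀ ℝ) = 0 := by
      unfold vecXY
      split_ifs with h1 h2
      · rw [show j = k + 1 by omega]; simp
      · simp
      · simp
    rw [h0, h1]
    simp
  by_cases h1 : i + j = k
  · have hkR : (k : ℝ) = i + j := by rw [← h1]; push_cast; rfl
    have e0 : (vecXY (i + 1) j : FrameIndex k w →₀ ℝ) = single .n ((-1 : ℝ) ^ i * (i + 1)) := by
      rw [vecXY, if_neg (by omega), if_pos (by omega), pow_succ]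
      congr 1
      push_cast
      ring
    have e1 : (vecXY i j : FrameIndex k w →₀ ℝ) = single .z ((-1) ^ i) := by
      rw [vecXY, if_pos (by omega)]
    have e2 : ((j - 1 : ℝ) * (k + 1 - j)) • (vecXY (i + 1) (j - 1) : FrameIndex k w →₀ ℝ) =
        single .z (-((j - 1 : ℝ) * (k + 1 - j) * (-1) ^ i)) := by
      rcases j with _ | _ | j
      · omega
      · simp
      · rw [vecXY, if_pos (by omega), Finsupp.smul_single, smul_eq_mul, pow_succ]
        congr 1
        ring
    rw [e0, e2, Nat.add_sub_cancel, e1, hn', smul_neg, Finsupp.smul_single, ← Finsupp.single_neg,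
      ← Finsupp.single_neg, ← Finsupp.single_add, ← Finsupp.single_add, Finsupp.single_eq_zero, hkR,
      smul_eq_mul]
    push_cast
    ring
  by_cases h2 : i + j = k + 1
  · have hkR : (k : ℝ) = i + j - 1 := by
      have : (i + j : ℝ) = k + 1 := by exact_mod_cast h2
      linarith
    have e0 : (vecXY (i + 1) j : FrameIndex k w →₀ ℝ) = 0 := by
      rw [vecXY, if_neg (by omega), if_neg (by omega)]
    have e1 : (vecXY i j : FrameIndex k w →₀ ℝ) = single .n (-((-1 : ℝ) ^ i * i)) := by
      rw [vecXY, if_neg (by omega), if_pos (by omega)]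
    have e2 : ((j - 1 : ℝ) * (k + 1 - j)) • (vecXY (i + 1) (j - 1) : FrameIndex k w →₀ ℝ) =
        single .n ((j - 1 : ℝ) * (k + 1 - j) * ((-1) ^ i * (i + 1))) := by
      rcases j with _ | _ | j
      · omega
      · simp
      · rw [vecXY, if_neg (by omega), if_pos (by omega), Finsupp.smul_single, smul_eq_mul, pow_succ]
        congr 1
        push_cast
        ring
    rw [e0, e2, Nat.add_sub_cancel, e1, map_zero, smul_neg, Finsupp.smul_single,
      ← Finsupp.single_neg, ← Finsupp.single_neg, zero_add, ← Finsupp.single_add,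
      Finsupp.single_eq_zero, hkR, smul_eq_mul]
    push_cast
    ring
  · have e0 : bracketForm α (single (.c hc : FrameIndex k w) 1) (vecXY (i + 1) j) = 0 := by
      unfold vecXY
      rw [if_neg (c := i + 1 + j = k + 1 ∧ 1 ≤ j) (by omega)]
      split_ifs
      · exact hz' _
      · simp
    have e1 : (vecXY i j : FrameIndex k w →₀ ℝ) = 0 := by
      rw [vecXY, if_neg (by omega), if_neg (by omega)]
    have e2 : (vecXY (i + 1) (j - 1) : FrameIndex k w →₀ ℝ) = 0 := by
      rw [vecXY, if_neg (by omega), if_neg (by omega)]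
    rw [e0, Nat.add_sub_cancel, e1, e2]
    simp

end Jacobi

end BigradedLieAlgebra

namespace BigradedLieAlgebra

section Jacobi

open Finsupp (single)

variable {k w : ℕ} {α : ℕ → ℕ → ℝ}

theorem jacobiator_eq_zero_of_lt (hα : IsBracketArray k w α) {p q r : FrameIndex k w}
    (h : p.bidegree.2 + q.bidegree.2 + r.bidegree.2 < -3) :
    jacobiator α (single p 1) (single q 1) (single r 1) = 0 := by
  simp only [jacobiator, bracketForm_single]
  rw [bracketForm_eq_zero_of_lt hα (bracketTable_mem_homogeneous hα q r)
      (by rw [Prod.snd_add]; omega),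
    bracketForm_eq_zero_of_lt hα (bracketTable_mem_homogeneous hα r p)
      (by rw [Prod.snd_add]; omega),
    bracketForm_eq_zero_of_lt hα (bracketTable_mem_homogeneous hα p q)
      (by rw [Prod.snd_add]; omega)]
  simp

theorem jacobiator_self (hα : IsBracketArray k w α) (u v : FrameIndex k w →₀ ℝ) :
    jacobiator α u u v = 0 := by
  have h := jacobiator_swap hα u u v
  exact self_eq_neg.1 h

/-- An auxiliary order on the labels, to use the symmetry of the Jacobi identity. -/
def FrameIndex.rank : FrameIndex k w → ℕ
  | .a => 0
  | .b => 1
  | .E => 2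
  | .c _ => 3
  | .x _ => 4
  | .y _ => 5
  | .z => 6
  | .n => 7

theorem jacobiator_single_of_rank_le {h : ℕ → ℕ → ℕ → ℝ} (hh : IsTripleArray k w h)
    {p q r : FrameIndex k w} (hpq : p.rank ≤ q.rank) (hqr : q.rank ≤ r.rank) :
    jacobiator (bracketArray k w h) (single p 1) (single q 1) (single r 1) = 0 := by
  have hα := hh.isBracketArray
  -- Apart from triples containing `a` or `b`, sorting and second degree at least `-3` leave mainly
  -- triples in `E`, `c`, `x`, `y`, together with `E, c, z` and `E, c, n`.
  by_cases hdeg : p.bidegree.2 + q.bidegree.2 + r.bidegree.2 < -3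
  · exact jacobiator_eq_zero_of_lt hα hdeg
  cases p with
  | a => exact jacobiator_a hα q r
  | b => exact jacobiator_b hα q r
  | E =>
    cases q with
    | E => exact jacobiator_self hα _ _
    | c hc =>
      cases r with
      | c hc' => rw [← jacobiator_rotate]; exact jacobiator_self hα _ _
      | x j => rw [single_x]; exact jacobiator_E_c_X hα hc j
      | y j => rw [single_y]; exact jacobiator_E_c_Y hα hc (by omega)
      | z => exact jacobiator_E_c_z hα hc
      | n => exact jacobiator_E_c_n hα hc
      | _ => simp [FrameIndex.rank] at hqr
    | x i =>
      cases r with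
      | x j => rw [single_x, single_x]; exact jacobiator_E_X_X hα i j
      | y j => rw [single_x, single_y]; exact jacobiator_E_X_Y hα i (by omega)
      | z => simp [FrameIndex.bidegree] at hdeg
      | n => simp [FrameIndex.bidegree] at hdeg
      | _ => simp [FrameIndex.rank] at hqr
    | a => simp [FrameIndex.rank] at hpq
    | b => simp [FrameIndex.rank] at hpq
    | _ => cases r <;> first
      | (simp [FrameIndex.rank] at hqr; done)
      | simp [FrameIndex.bidegree] at hdeg
  | c hc =>
    cases q with
    | c hc' => exact jacobiator_self hα _ _
    | x i =>
      cases r with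
      | x j =>
        rw [single_x, single_x]
        exact jacobiator_c_X_X hα hc (hh.special_bracketArray hc) i j
      | y j => rw [single_x, single_y]; exact jacobiator_c_X_Y hα hc i (by omega)
      | z => simp [FrameIndex.bidegree] at hdeg
      | n => simp [FrameIndex.bidegree] at hdeg
      | _ => simp [FrameIndex.rank] at hqr
    | a => simp [FrameIndex.rank] at hpq
    | b => simp [FrameIndex.rank] at hpq
    | E => simp [FrameIndex.rank] at hpq
    | _ => cases r <;> first
      | (simp [FrameIndex.rank] at hqr; done)
      | simp [FrameIndex.bidegree] at hdeg
  | x i =>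
    cases q with
    | x j =>
      cases r with
      | x l =>
        rw [single_x, single_x, single_x]
        exact jacobiator_X_X_X hα hh.jacobi_z hh.jacobi_n i j l
      | _ => first
        | (simp [FrameIndex.rank] at hqr; done)
        | simp [FrameIndex.bidegree] at hdeg
    | _ => first
      | (simp [FrameIndex.rank] at hpq; done)
      | (cases r <;> first
          | (simp [FrameIndex.rank] at hqr; done)
          | simp [FrameIndex.bidegree] at hdeg)
  | _ => cases q <;> first
    | (simp [FrameIndex.rank] at hpq; done)
    | (cases r <;> first
        | (simp [FrameIndex.rank] at hqr; done)
        | simp [FrameIndex.bidegree] at hdeg)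

theorem jacobiator_single {h : ℕ → ℕ → ℕ → ℝ} (hh : IsTripleArray k w h)
    (p q r : FrameIndex k w) :
    jacobiator (bracketArray k w h) (single p 1) (single q 1) (single r 1) = 0 := by
  have hα := hh.isBracketArray
  have sw : ∀ u v t : FrameIndex k w →₀ ℝ, jacobiator (bracketArray k w h) u v t = 0 →
      jacobiator (bracketArray k w h) v u t = 0 := fun u v t huv => by
    rw [jacobiator_swap hα, huv, neg_zero]
  have rot : ∀ u v t : FrameIndex k w →₀ ℝ, jacobiator (bracketArray k w h) u v t = 0 →
      jacobiator (bracketArray k w h) v t u = 0 := fun u v t huv => by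
    rw [jacobiator_rotate, huv]
  rcases le_total p.rank q.rank with h1 | h1 <;> rcases le_total q.rank r.rank with h2 | h2 <;>
    rcases le_total p.rank r.rank with h3 | h3
  · exact jacobiator_single_of_rank_le hh h1 h2
  · exact jacobiator_single_of_rank_le hh h1 h2
  · exact sw _ _ _ (rot _ _ _ (rot _ _ _ (jacobiator_single_of_rank_le hh h3 h2)))
  · exact rot _ _ _ (jacobiator_single_of_rank_le hh h3 h1)
  · exact sw _ _ _ (jacobiator_single_of_rank_le hh h1 h3)
  · exact rot _ _ _ (rot _ _ _ (jacobiator_single_of_rank_le hh h2 h3))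
  · exact sw _ _ _ (rot _ _ _ (jacobiator_single_of_rank_le hh h2 h1))
  · exact sw _ _ _ (rot _ _ _ (jacobiator_single_of_rank_le hh h2 h1))

theorem bracketForm_leibniz {h : ℕ → ℕ → ℕ → ℝ} (hh : IsTripleArray k w h)
    (u v t : FrameIndex k w →₀ ℝ) :
    bracketForm (bracketArray k w h) u (bracketForm (bracketArray k w h) v t) =
      bracketForm (bracketArray k w h) (bracketForm (bracketArray k w h) u v) t +
      bracketForm (bracketArray k w h) v (bracketForm (bracketArray k w h) u t) := by
  have hα := hh.isBracketArray
  suffices H : jacobiator (bracketArray k w h) u v t = 0 by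
    rw [jacobiator] at H
    rw [bracketForm_antisymm hα (bracketForm _ u v) t, bracketForm_antisymm hα u t, map_neg,
      ← neg_add, ← add_eq_zero_iff_eq_neg, ← H]
    abel
  induction u using Finsupp.induction_linear with
  | zero => simp [jacobiator]
  | add u u' hu hu' =>
    -- The zero on the right is split and each half replaced by one of the two jacobiators, so that
    -- the goal becomes additivity.
    rw [← add_zero (0 : FrameIndex k w →₀ ℝ)]
    nth_rewrite 1 [← hu]
    rw [← hu']
    simp only [jacobiator, map_add, LinearMap.add_apply]
    abel
  | single p c =>
  induction v using Finsupp.induction_linear with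
  | zero => simp [jacobiator]
  | add u u' hu hu' =>
    rw [← add_zero (0 : FrameIndex k w →₀ ℝ)]
    nth_rewrite 1 [← hu]
    rw [← hu']
    simp only [jacobiator, map_add, LinearMap.add_apply]
    abel
  | single q d =>
  induction t using Finsupp.induction_linear with
  | zero => simp [jacobiator]
  | add u u' hu hu' =>
    rw [← add_zero (0 : FrameIndex k w →₀ ℝ)]
    nth_rewrite 1 [← hu]
    rw [← hu']
    simp only [jacobiator, map_add, LinearMap.add_apply]
    abel
  | single r e =>
    have e1 : ∀ (p : FrameIndex k w) (c : ℝ), single p c = c • single p (1 : ℝ) := by simp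
    rw [e1 p c, e1 q d, e1 r e]
    have h3 := jacobiator_single hh p q r
    have h4 : jacobiator (bracketArray k w h) (c • single p 1) (d • single q 1) (e • single r 1)
        = (c * d * e) • jacobiator (bracketArray k w h) (single p 1) (single q 1) (single r 1) := by
      simp only [jacobiator, map_smul, LinearMap.smul_apply]
      module
    rw [h4, h3, smul_zero]

end Jacobi

end BigradedLieAlgebra

/-! ### The model algebra of a triple array. -/

namespace BigradedLieAlgebra

section Model

open Finsupp (single)

variable {k w : ℕ}

theorem bracketForm_mem_homogeneous {α : ℕ → ℕ → ℝ} (hα : IsBracketArray k w α)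
    {u v : FrameIndex k w →₀ ℝ} {m n : ℤ × ℤ} (hu : u ∈ homogeneous m) (hv : v ∈ homogeneous n) :
    bracketForm α u v ∈ (homogeneous (m + n) : Submodule ℝ (FrameIndex k w →₀ ℝ)) := by
  simp only [bracketForm, Finsupp.linearCombination_apply, Finsupp.sum, LinearMap.sum_apply,
    LinearMap.smul_apply]
  refine Submodule.sum_mem _ fun p hp => Submodule.smul_mem _ _ <|
    Submodule.sum_mem _ fun q hq => Submodule.smul_mem _ _ ?_
  have hp' : p.bidegree = m := hu hp
  have hq' : q.bidegree = n := hv hq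
  rw [← hp', ← hq']
  exact bracketTable_mem_homogeneous hα p q

/-- The Lie ring defined by a triple array. -/
@[reducible] noncomputable def modelLieRing {h : ℕ → ℕ → ℕ → ℝ} (hh : IsTripleArray k w h) :
    LieRing (ULift.{u} (FrameIndex k w →₀ ℝ)) where
  bracket x y := ⟨bracketForm (bracketArray k w h) x.down y.down⟩
  add_lie x y z := by
    ext1
    change bracketForm _ (x.down + y.down) z.down = _
    rw [map_add]; rfl
  lie_add x y z := by
    ext1
    change bracketForm _ x.down (y.down + z.down) = _
    rw [map_add]; rfl
  lie_self x := by
    ext1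
    exact self_eq_neg.1 (bracketForm_antisymm hh.isBracketArray x.down x.down)
  leibniz_lie x y z := by
    ext1
    exact bracketForm_leibniz hh x.down y.down z.down

/-- The Lie algebra defined by a triple array. -/
@[reducible] noncomputable def modelLieAlgebra {h : ℕ → ℕ → ℕ → ℝ} (hh : IsTripleArray k w h) :
    @LieAlgebra ℝ (ULift.{u} (FrameIndex k w →₀ ℝ)) _ (modelLieRing hh) :=
  letI := modelLieRing.{u} hh
  { lie_smul := fun t x y => by
      ext1
      change bracketForm _ x.down (t • y.down) = _
      rw [map_smul]; rfl }

/-- The standard basis of the model. -/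
noncomputable def modelBasis (k w : ℕ) :
    Module.Basis (FrameIndex k w) ℝ (ULift.{u} (FrameIndex k w →₀ ℝ)) :=
  .ofRepr ULift.moduleEquiv

/-- The bi-grading of the model. -/
noncomputable def modelGrading (k w : ℕ) (p : ℤ × ℤ) : Submodule ℝ (ULift.{u} (FrameIndex k w →₀ ℝ)) :=
  Submodule.span ℝ (modelBasis k w '' {i | i.bidegree = p})

theorem mem_modelGrading {p : ℤ × ℤ} {v : ULift.{u} (FrameIndex k w →₀ ℝ)} :
    v ∈ modelGrading k w p ↔ v.down ∈ (homogeneous p : Submodule ℝ (FrameIndex k w →₀ ℝ)) :=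
  (modelBasis k w).mem_span_image

theorem isInternal_modelGrading (k w : ℕ) : DirectSum.IsInternal (modelGrading.{u} k w) := by
  refine DirectSum.isInternal_submodule_of_iSupIndep_of_iSup_eq_top ?_ ?_
  · intro p
    have h : ⨆ q, ⨆ (_ : q ≠ p), modelGrading.{u} k w q ≤
        Submodule.span ℝ (modelBasis k w '' {i | i.bidegree ≠ p}) := by
      refine iSup_le fun q => iSup_le fun hq => Submodule.span_mono (Set.image_mono ?_)
      rintro i rfl
      exact hq
    refine Disjoint.mono_right h ((modelBasis k w).linearIndependent.disjoint_span_image ?_)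
    exact disjoint_compl_right
  · rw [eq_top_iff, ← (modelBasis k w).span_eq, Submodule.span_le]
    rintro _ ⟨i, rfl⟩
    exact Submodule.mem_iSup_of_mem i.bidegree (Submodule.subset_span ⟨i, rfl, rfl⟩)

/-- The bi-graded Lie algebra defined by a triple array. -/
noncomputable def model {h : ℕ → ℕ → ℕ → ℝ} (hh : IsTripleArray k w h) :
    BigradedLieAlgebra.{u} :=
  letI := modelLieRing.{u} hh
  letI := modelLieAlgebra.{u} hh
  { carrier := ULift.{u} (FrameIndex k w →₀ ℝ)
    grading := modelGrading k w
    graded :=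
      { (isInternal_modelGrading k w).chooseDecomposition with
        bracket_mem := fun _ _ _ _ hu hv => mem_modelGrading.2
          (bracketForm_mem_homogeneous hh.isBracketArray (mem_modelGrading.1 hu)
            (mem_modelGrading.1 hv)) } }

section Basis

variable {L : Type u} [LieRing L] [LieAlgebra ℝ L] (e : Module.Basis (FrameIndex k w) ℝ L)

theorem repr_frameX (j : ℕ) : e.repr (frameX e j) = vecX j := by
  unfold frameX vecX
  split_ifs <;> simp

theorem repr_frameY (j : ℕ) : e.repr (frameY e j) = vecY j := by
  unfold frameY vecY
  split_ifs <;> simp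

end Basis

/-- The standard basis of the model as a basis of a bi-graded Lie algebra. -/
noncomputable def modelFrame {h : ℕ → ℕ → ℕ → ℝ} (hh : IsTripleArray k w h) :
    Module.Basis (FrameIndex k w) ℝ (model.{u} hh) :=
  modelBasis.{u} k w

theorem modelFrame_repr_lie {h : ℕ → ℕ → ℕ → ℝ} (hh : IsTripleArray k w h) (u v : model.{u} hh) :
    (modelFrame hh).repr ⁅u, v⁆ =
      bracketForm (bracketArray k w h) ((modelFrame hh).repr u) ((modelFrame hh).repr v) :=
  rfl

theorem modelFrame_isFrame {h : ℕ → ℕ → ℕ → ℝ} (hh : IsTripleArray k w h) (hk : 1 ≤ k)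
    (h1 : bracketArray k w h 0 w = 1) : (model.{u} hh).IsFrame (modelFrame hh) := by
  have hα := hh.isBracketArray
  have hX : ∀ j, (modelFrame.{u} hh).repr (frameX (modelFrame hh) j) = vecX j := repr_frameX _
  have hY : ∀ j, (modelFrame.{u} hh).repr (frameY (modelFrame hh) j) = vecY j := repr_frameY _
  constructor
  case grading_eq => exact fun p => rfl
  all_goals
    intros
    apply (modelFrame hh).repr.injective
    simp only [modelFrame_repr_lie, hX, hY, map_zero, map_neg, map_add, map_smul,
      Module.Basis.repr_self, bracketForm_single, bracketForm_E_X, bracketForm_X_X hα,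
      bracketForm_X_Y]
  case x_x => rw [h1, one_smul, show 0 + w + 1 - w = 1 by omega]
  case E_y => exact bracketForm_E_Y ‹_›
  case x_y => rw [vecXY, if_pos (by omega), pow_zero]
  case E_z => rfl
  case a_x => rw [bracketForm_a _ (vecX_mem_homogeneous rfl)]; simp
  case b_x => rw [bracketForm_b _ (vecX_mem_homogeneous rfl)]; simp
  case c_x => rw [bracketForm_c_X]; simp
  all_goals simp [bracketTable, FrameIndex.bidegree]

theorem structureConstants_modelFrame {h : ℕ → ℕ → ℕ → ℝ} (hh : IsTripleArray k w h) :
    structureConstants (modelFrame.{u} hh) = fun p q r => bracketTable (bracketArray k w h) p q r := by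
  funext p q r
  rw [structureConstants, modelFrame_repr_lie, Module.Basis.repr_self, Module.Basis.repr_self,
    bracketForm_single]

end Model

end BigradedLieAlgebra

/-! ### Brackets forced by the frame relations. -/

namespace BigradedLieAlgebra

open Finsupp (single)

section Homogeneous

variable {k w : ℕ}

theorem eq_zero_of_mem_homogeneous {u : FrameIndex k w →₀ ℝ} {m : ℤ × ℤ} (hu : u ∈ homogeneous m)
    (h : ∀ r : FrameIndex k w, r.bidegree ≠ m) : u = 0 := by
  ext r
  by_contra hr
  exact h r (hu (Finsupp.mem_support_iff.2 hr))

theorem eq_smul_of_mem_homogeneous {u : FrameIndex k w →₀ ℝ} {m : ℤ × ℤ} (hu : u ∈ homogeneous m)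
    (r : FrameIndex k w) (h : ∀ q : FrameIndex k w, q.bidegree = m → q = r) :
    u = u r • single r 1 := by
  ext q
  by_cases hq : q = r
  · simp [hq]
  · have : u q = 0 := by
      by_contra hu'
      exact hq (h q (hu (Finsupp.mem_support_iff.2 hu')))
    simp [this, hq]

end Homogeneous

namespace IsFrame

variable {k w : ℕ} {A : BigradedLieAlgebra.{u}} {e : Module.Basis (FrameIndex k w) ℝ A}

theorem mem_grading_iff (hF : A.IsFrame e) {p : ℤ × ℤ} {v : A} :
    v ∈ A.grading p ↔ e.repr v ∈ (homogeneous p : Submodule ℝ (FrameIndex k w →₀ ℝ)) := by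
  rw [hF.grading_eq, e.mem_span_image]
  rfl

theorem mem_grading (hF : A.IsFrame e) (p : FrameIndex k w) : e p ∈ A.grading p.bidegree := by
  rw [hF.mem_grading_iff, e.repr_self]
  exact single_mem_homogeneous rfl _

theorem frameX_mem (hF : A.IsFrame e) (j : ℕ) : frameX e j ∈ A.grading (-(j : ℤ), -1) := by
  rw [hF.mem_grading_iff, repr_frameX]
  exact vecX_mem_homogeneous rfl

theorem frameY_mem (hF : A.IsFrame e) (j : ℕ) :
    frameY e j ∈ A.grading (-((w : ℤ) + j - 1), -2) := by
  rw [hF.mem_grading_iff, repr_frameY]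
  exact vecY_mem_homogeneous rfl

theorem lie_mem {u v : A} {p q : ℤ × ℤ} (hu : u ∈ A.grading p) (hv : v ∈ A.grading q) :
    ⁅u, v⁆ ∈ A.grading (p + q) :=
  SetLike.GradedBracket.bracket_mem hu hv

theorem eq_zero (hF : A.IsFrame e) {v : A} {p : ℤ × ℤ} (hv : v ∈ A.grading p)
    (h : ∀ r : FrameIndex k w, r.bidegree ≠ p) : v = 0 := by
  have := eq_zero_of_mem_homogeneous (hF.mem_grading_iff.1 hv) h
  simpa using this

theorem eq_smul (hF : A.IsFrame e) {v : A} {p : ℤ × ℤ} (hv : v ∈ A.grading p)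
    (r : FrameIndex k w) (h : ∀ q : FrameIndex k w, q.bidegree = p → q = r) :
    v = e.repr v r • e r := by
  apply e.repr.injective
  rw [map_smul, e.repr_self]
  exact eq_smul_of_mem_homogeneous (hF.mem_grading_iff.1 hv) r h

/-- For `j = k` the bracket falls into a bi-degree without frame elements; for larger `j` both sides
are zero by convention. -/
theorem lie_E_frameX (hF : A.IsFrame e) (j : ℕ) : ⁅e .E, frameX e j⁆ = frameX e (j + 1) := by
  rcases lt_trichotomy j k with h | h | h
  · exact hF.E_x j h
  · have h1 : frameX e (j + 1) = 0 := dif_neg (by omega)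
    rw [h1]
    refine hF.eq_zero (lie_mem (hF.mem_grading _) (hF.frameX_mem j)) fun r => ?_
    cases r <;> simp [FrameIndex.bidegree]
    omega
  · have h1 : frameX e (j + 1) = 0 := dif_neg (by omega)
    have h2 : frameX e j = 0 := dif_neg (by omega)
    rw [h1, h2, lie_zero]

theorem lie_E_frameY (hF : A.IsFrame e) {j : ℕ} (hj : 1 ≤ j) :
    ⁅e .E, frameY e j⁆ = frameY e (j + 1) := by
  rcases lt_trichotomy j k with h | h | h
  · exact hF.E_y j hj h
  · have h1 : frameY e (j + 1) = 0 := dif_neg (by omega)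
    rw [h1]
    refine hF.eq_zero (lie_mem (hF.mem_grading _) (hF.frameY_mem j)) fun r => ?_
    cases r <;> simp [FrameIndex.bidegree]
    omega
  · have h1 : frameY e (j + 1) = 0 := dif_neg (by omega)
    have h2 : frameY e j = 0 := dif_neg (by omega)
    rw [h1, h2, lie_zero]

theorem lie_E_n (hF : A.IsFrame e) : ⁅e .E, e .n⁆ = 0 := by
  refine hF.eq_zero (lie_mem (hF.mem_grading _) (hF.mem_grading _)) fun r => ?_
  cases r <;> simp [FrameIndex.bidegree]
  all_goals omega

theorem lie_lie_of_eigen {D u v : A} {r s : ℝ} (hu : ⁅D, u⁆ = r • u) (hv : ⁅D, v⁆ = s • v) :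
    ⁅D, ⁅u, v⁆⁆ = (r + s) • ⁅u, v⁆ := by
  rw [leibniz_lie, hu, hv, smul_lie, lie_smul, add_smul]

section Eigen

variable {D : A} {r s : ℝ}

/-- Eigenvalues of `ad D` add under brackets, and all of `x_j, y_j, z, n` are iterated brackets of
`E` and `x_0`. Used with `D = a` and `D = b`. -/
theorem eigen_frameX (hE : ⁅D, e .E⁆ = r • e .E)
    (h0 : ⁅D, frameX e 0⁆ = s • frameX e 0) (hF : A.IsFrame e) (j : ℕ) :
    ⁅D, frameX e j⁆ = (j * r + s) • frameX e j := by
  induction j with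
  | zero => simpa using h0
  | succ j ih =>
    rw [← hF.lie_E_frameX, lie_lie_of_eigen hE ih]
    congr 1
    push_cast
    ring

theorem eigen_frameY (hE : ⁅D, e .E⁆ = r • e .E)
    (h0 : ⁅D, frameX e 0⁆ = s • frameX e 0) (hF : A.IsFrame e) {j : ℕ} (hj : 1 ≤ j) :
    ⁅D, frameY e j⁆ = ((w + j - 1) * r + 2 * s) • frameY e j := by
  induction j, hj using Nat.le_induction with
  | base =>
    rw [← hF.x_x, lie_lie_of_eigen h0 (eigen_frameX hE h0 hF w)]
    congr 1
    push_cast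
    ring
  | succ j hj ih =>
    rw [← hF.lie_E_frameY hj, lie_lie_of_eigen hE ih]
    congr 1
    push_cast
    ring

theorem eigen_z (hE : ⁅D, e .E⁆ = r • e .E)
    (h0 : ⁅D, frameX e 0⁆ = s • frameX e 0) (hF : A.IsFrame e) (hk : 1 ≤ k) :
    ⁅D, e .z⁆ = ((w + k - 1) * r + 3 * s) • e .z := by
  rw [← hF.x_y, lie_lie_of_eigen h0 (eigen_frameY hE h0 hF hk)]
  congr 1
  ring

theorem eigen_n (hE : ⁅D, e .E⁆ = r • e .E)
    (h0 : ⁅D, frameX e 0⁆ = s • frameX e 0) (hF : A.IsFrame e) (hk : 1 ≤ k) :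
    ⁅D, e .n⁆ = ((w + k) * r + 3 * s) • e .n := by
  rw [← hF.E_z, lie_lie_of_eigen hE (eigen_z hE h0 hF hk)]
  congr 1
  ring

end Eigen

theorem apply_x (j : Fin (k + 1)) : e (.x j) = frameX e j := by
  rw [frameX, dif_pos j.2]

theorem apply_y (j : Fin k) : e (.y j) = frameY e (j + 1) := by
  rw [frameY, dif_pos ⟨by omega, by omega⟩]
  rfl

theorem lie_a (hF : A.IsFrame e) (hk : 1 ≤ k) (p : FrameIndex k w) :
    ⁅e .a, e p⁆ = (-(p.bidegree.1 : ℝ)) • e p := by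
  have hE : ⁅e .a, e .E⁆ = (1 : ℝ) • e .E := by rw [hF.a_E, one_smul]
  have h0 : ⁅e .a, frameX e 0⁆ = (0 : ℝ) • frameX e 0 := by rw [hF.a_x, zero_smul]
  cases p with
  | E => rw [hE]; simp [FrameIndex.bidegree]
  | x j => rw [apply_x, eigen_frameX hE h0 hF]; simp [FrameIndex.bidegree]
  | y j =>
    rw [apply_y, eigen_frameY hE h0 hF (by omega)]
    congr 1
    simp only [FrameIndex.bidegree]
    push_cast
    ring
  | z =>
    rw [eigen_z hE h0 hF hk]
    congr 1
    simp only [FrameIndex.bidegree]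
    push_cast
    ring
  | n =>
    rw [eigen_n hE h0 hF hk]
    congr 1
    simp only [FrameIndex.bidegree]
    push_cast
    ring
  | a => simp [FrameIndex.bidegree]
  | b => rw [hF.a_b]; simp [FrameIndex.bidegree]
  | c h => rw [hF.a_c]; simp [FrameIndex.bidegree]

theorem lie_b (hF : A.IsFrame e) (hk : 1 ≤ k) (p : FrameIndex k w) :
    ⁅e .b, e p⁆ = (-(p.bidegree.2 : ℝ)) • e p := by
  have hE : ⁅e .b, e .E⁆ = (0 : ℝ) • e .E := by rw [hF.b_E, zero_smul]
  have h0 : ⁅e .b, frameX e 0⁆ = (1 : ℝ) • frameX e 0 := by rw [hF.b_x, one_smul]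
  cases p with
  | E => rw [hE]; simp [FrameIndex.bidegree]
  | x j => rw [apply_x, eigen_frameX hE h0 hF]; simp [FrameIndex.bidegree]
  | y j => rw [apply_y, eigen_frameY hE h0 hF (by omega)]; simp [FrameIndex.bidegree]
  | z => rw [eigen_z hE h0 hF hk]; simp [FrameIndex.bidegree]
  | n => rw [eigen_n hE h0 hF hk]; simp [FrameIndex.bidegree]
  | a => rw [← lie_skew, hF.a_b]; simp [FrameIndex.bidegree]
  | b => simp [FrameIndex.bidegree]
  | c h => rw [← lie_skew, hF.c_b]; simp [FrameIndex.bidegree]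

theorem lie_a_frameX (hF : A.IsFrame e) (j : ℕ) : ⁅e .a, frameX e j⁆ = (j : ℝ) • frameX e j := by
  rw [eigen_frameX (r := 1) (s := 0) (by rw [hF.a_E, one_smul]) (by rw [hF.a_x, zero_smul]) hF]
  simp

theorem lie_b_frameX (hF : A.IsFrame e) (j : ℕ) : ⁅e .b, frameX e j⁆ = frameX e j := by
  rw [eigen_frameX (r := 0) (s := 1) (by rw [hF.b_E, zero_smul]) (by rw [hF.b_x, one_smul]) hF]
  simp

theorem lie_a_frameY (hF : A.IsFrame e) {j : ℕ} (hj : 1 ≤ j) :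
    ⁅e .a, frameY e j⁆ = (w + j - 1 : ℝ) • frameY e j := by
  rw [eigen_frameY (r := 1) (s := 0) (by rw [hF.a_E, one_smul]) (by rw [hF.a_x, zero_smul]) hF hj]
  simp

theorem lie_b_frameY (hF : A.IsFrame e) {j : ℕ} (hj : 1 ≤ j) :
    ⁅e .b, frameY e j⁆ = (2 : ℝ) • frameY e j := by
  rw [eigen_frameY (r := 0) (s := 1) (by rw [hF.b_E, zero_smul]) (by rw [hF.b_x, one_smul]) hF hj]
  simp

theorem lie_c_lie_E (hF : A.IsFrame e) (hc : 2 * w = k + 1) (u : A) :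
    ⁅e (.c hc), ⁅e .E, u⁆⁆ = (-2 : ℝ) • ⁅e .a, u⁆ + (k : ℝ) • ⁅e .b, u⁆
      + ⁅e .E, ⁅e (.c hc), u⁆⁆ := by
  rw [leibniz_lie, hF.c_E, add_lie, smul_lie, smul_lie]

/-- The usual `sl₂` induction up the `E`-string from `x_0`, which `c` kills: each step adds the
eigenvalue `k - 2j` of `[c, E]` on `x_j`. -/
theorem lie_c_frameX (hF : A.IsFrame e) (hc : 2 * w = k + 1) (j : ℕ) :
    ⁅e (.c hc), frameX e j⁆ = (j * (k + 1 - j) : ℝ) • frameX e (j - 1) := by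
  induction j with
  | zero => rw [hF.c_x]; simp
  | succ j ih =>
    rw [← hF.lie_E_frameX, hF.lie_c_lie_E, ih, hF.lie_a_frameX, hF.lie_b_frameX, lie_smul,
      hF.lie_E_frameX, Nat.add_sub_cancel]
    rcases j with _ | j
    · simp
    · rw [Nat.add_sub_cancel]
      push_cast
      module

theorem lie_c_frameY (hF : A.IsFrame e) (hc : 2 * w = k + 1) {j : ℕ} (hj : 1 ≤ j) :
    ⁅e (.c hc), frameY e j⁆ = ((j - 1) * (k + 1 - j) : ℝ) • frameY e (j - 1) := by
  induction j, hj using Nat.le_induction with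
  | base =>
    rw [Nat.cast_one, sub_self, zero_mul, zero_smul]
    -- The bracket of `c` and `y_1` has bi-degree `(-(w-1), -2)`, where the frame has no element.
    refine hF.eq_zero (lie_mem (hF.mem_grading _) (hF.frameY_mem 1)) fun r => ?_
    cases r <;> simp [FrameIndex.bidegree]
    omega
  | succ j hj ih =>
    have hc' : (2 * w : ℝ) = k + 1 := by exact_mod_cast hc
    have hw' : (w : ℝ) = (k + 1) / 2 := by linarith
    rw [← hF.lie_E_frameY hj, hF.lie_c_lie_E, ih, hF.lie_a_frameY hj, hF.lie_b_frameY hj, lie_smul,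
      Nat.add_sub_cancel, hw']
    rcases eq_or_lt_of_le hj with rfl | hj
    · push_cast
      simp only [sub_self, zero_mul, zero_smul, add_zero]
      module
    · rw [hF.lie_E_frameY (by omega), Nat.sub_add_cancel (by omega)]
      push_cast
      module

theorem lie_c_z (hF : A.IsFrame e) (hc : 2 * w = k + 1) : ⁅e (.c hc), e .z⁆ = 0 := by
  refine hF.eq_zero (lie_mem (hF.mem_grading _) (hF.mem_grading _)) fun r => ?_
  cases r <;> simp [FrameIndex.bidegree]
  all_goals omega

theorem lie_c_n (hF : A.IsFrame e) (hk : 1 ≤ k) (hc : 2 * w = k + 1) :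
    ⁅e (.c hc), e .n⁆ = e .z := by
  have hc' : (2 * w : ℝ) = k + 1 := by exact_mod_cast hc
  have hw' : (w : ℝ) = (k + 1) / 2 := by linarith
  rw [← hF.E_z, hF.lie_c_lie_E, hF.lie_c_z, lie_zero, hF.lie_a hk, hF.lie_b hk]
  simp only [FrameIndex.bidegree]
  push_cast
  rw [hw']
  module

/-- Induction on `i` through `[x_{i+1}, y_j] = [E, [x_i, y_j]] - [x_i, y_{j+1}]`. On the line `i + j
= k` the first term is zero and the sign alternates; on `i + j = k + 1` it contributes one more
multiple of `n` at each step, starting from `y_{k+1} = 0`. -/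
theorem repr_lie_frameX_frameY (hF : A.IsFrame e) (i : ℕ) {j : ℕ} (hj : 1 ≤ j) :
    e.repr ⁅frameX e i, frameY e j⁆ = vecXY i j := by
  have hmem : ∀ i j, ⁅frameX e i, frameY e j⁆ ∈ A.grading _ := fun i j =>
    lie_mem (hF.frameX_mem i) (hF.frameY_mem j)
  have hL : ∀ i j, 1 ≤ j → ⁅frameX e (i + 1), frameY e j⁆ =
      ⁅e .E, ⁅frameX e i, frameY e j⁆⁆ - ⁅frameX e i, frameY e (j + 1)⁆ := by
    intro i j hj
    rw [leibniz_lie, hF.lie_E_frameX, hF.lie_E_frameY hj]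
    abel
  have hz : ∀ i j, 1 ≤ j → i + j = k → ⁅frameX e i, frameY e j⁆ = ((-1) ^ i : ℝ) • e .z := by
    intro i
    induction i with
    | zero =>
      rintro j hj hjk
      rw [show j = k by omega, hF.x_y]; simp
    | succ i ih =>
      intro j hj hjk
      have h0 : ⁅frameX e i, frameY e j⁆ = 0 := by
        refine hF.eq_zero (hmem i j) fun r => ?_
        cases r <;> simp [FrameIndex.bidegree]
        all_goals omega
      rw [hL i j hj, h0, lie_zero, ih (j + 1) (by omega) (by omega), pow_succ]
      module
  have hn : ∀ i j, 1 ≤ j → i + j = k + 1 →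
      ⁅frameX e i, frameY e j⁆ = (-((-1) ^ i * i) : ℝ) • e .n := by
    intro i
    induction i with
    | zero =>
      rintro j hj hjk
      have : frameY e j = 0 := dif_neg (by omega)
      rw [this]; simp
    | succ i ih =>
      intro j hj hjk
      rw [hL i j hj, hz i j hj (by omega), ih (j + 1) (by omega) (by omega), lie_smul, hF.E_z,
        pow_succ]
      push_cast
      module
  unfold vecXY
  split_ifs with h1 h2
  · rw [hz i j hj h1.1]; simp
  · rw [hn i j hj h2.1]
    rw [map_smul, e.repr_self, Finsupp.smul_single, smul_eq_mul, mul_one]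
  · have h0 : ⁅frameX e i, frameY e j⁆ = 0 := by
      refine hF.eq_zero (hmem i j) fun r => ?_
      cases r <;> simp [FrameIndex.bidegree]
      all_goals omega
    rw [h0, map_zero]

end IsFrame

end BigradedLieAlgebra

/-! ### The coefficient array of a frame as an isomorphism invariant. -/

namespace BigradedLieAlgebra

open Finsupp (single)

section Coefficients

variable {k w : ℕ} {A : BigradedLieAlgebra.{u}}

/-- The coefficients `α i j` in `[x_i, x_j] = α i j • y_{i + j - w + 1}`. -/
noncomputable def frameArray (e : Module.Basis (FrameIndex k w) ℝ A) (i j : ℕ) : ℝ :=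
  if h : w ≤ i + j ∧ i + j < w + k then
    e.repr ⁅frameX e i, frameX e j⁆ (.y ⟨i + j - w, by omega⟩) else 0

variable {e : Module.Basis (FrameIndex k w) ℝ A}

theorem frameY_ne_zero {j : ℕ} (h : 1 ≤ j ∧ j ≤ k) : frameY e j ≠ 0 := by
  rw [frameY, dif_pos h]
  exact e.ne_zero _

namespace IsFrame

theorem lie_frameX_frameX (hF : A.IsFrame e) (i j : ℕ) :
    ⁅frameX e i, frameX e j⁆ = frameArray e i j • frameY e (i + j + 1 - w) := by
  have hmem := lie_mem (hF.frameX_mem i) (hF.frameX_mem j)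
  by_cases h : w ≤ i + j ∧ i + j < w + k
  · rw [frameArray, dif_pos h, frameY, dif_pos (by omega)]
    have h1 : (⟨i + j + 1 - w - 1, by omega⟩ : Fin k) = ⟨i + j - w, by omega⟩ :=
      Fin.ext (by simp only; omega)
    rw [h1]
    refine hF.eq_smul hmem _ fun q hq => ?_
    cases q <;> simp [FrameIndex.bidegree] at hq ⊢
    apply Fin.ext
    simp only
    omega
  · rw [frameArray, dif_neg h, zero_smul]
    refine hF.eq_zero hmem fun r => ?_
    cases r <;> simp [FrameIndex.bidegree]
    omega

theorem frameArray_of_add_lt (e : Module.Basis (FrameIndex k w) ℝ A) (i j : ℕ) (h : i + j < w) :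
    frameArray e i j = 0 :=
  dif_neg (by omega)

theorem frameArray_of_le_add (e : Module.Basis (FrameIndex k w) ℝ A) (i j : ℕ)
    (h : w + k ≤ i + j) : frameArray e i j = 0 :=
  dif_neg (by omega)

theorem isBracketArray (hF : A.IsFrame e) : IsBracketArray k w (frameArray e) := by
  have hanti : ∀ i j, frameArray e i j = -frameArray e j i := by
    intro i j
    by_cases h : w ≤ i + j ∧ i + j < w + k
    · rw [frameArray, frameArray, dif_pos h, dif_pos (by omega), ← lie_skew, map_neg,
        Finsupp.neg_apply]
      simp only [add_comm i j]
    · rw [frameArray, frameArray, dif_neg h, dif_neg (by omega), neg_zero]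
  refine ⟨hanti, frameArray_of_add_lt e, frameArray_of_le_add e, ?_, ?_, ?_⟩
  · intro i j hi
    have h0 : frameX e i = 0 := dif_neg (by omega)
    unfold frameArray
    split_ifs
    · simp [h0]
    · rfl
  · intro i j hij
    by_cases h1 : i + j + 1 < w
    · rw [frameArray_of_add_lt e _ _ (by omega), frameArray_of_add_lt e _ _ (by omega),
        frameArray_of_add_lt e _ _ (by omega), add_zero]
    have hL : ⁅e .E, ⁅frameX e i, frameX e j⁆⁆ =
        (frameArray e (i + 1) j + frameArray e i (j + 1)) • frameY e (i + j + 2 - w) := by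
      rw [leibniz_lie, hF.lie_E_frameX, hF.lie_E_frameX, hF.lie_frameX_frameX,
        hF.lie_frameX_frameX, add_smul, show i + 1 + j + 1 - w = i + j + 2 - w by omega,
        show i + (j + 1) + 1 - w = i + j + 2 - w by omega]
    have hY : frameY e (i + j + 2 - w) ≠ 0 := frameY_ne_zero (by omega)
    rw [hF.lie_frameX_frameX, lie_smul] at hL
    -- The case of `y_0 = 0` again, where `ad E` does not raise the index.
    by_cases h2 : i + j + 1 = w
    · rw [frameArray_of_add_lt e i j (by omega)] at hL ⊢
      rw [zero_smul] at hL
      exact (smul_eq_zero.1 hL.symm).resolve_right hY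
    · rw [hF.lie_E_frameY (by omega), show i + j + 1 - w + 1 = i + j + 2 - w by omega] at hL
      exact (smul_left_injective ℝ hY hL).symm
  · intro j l hjl
    -- For `j + l = w + k` the Jacobi sum lies in the line of `n`; its coordinate there is the
    -- reflection relation.
    have hJ := lie_jacobi (frameX e 0) (frameX e j) (frameX e l)
    rw [hF.lie_frameX_frameX, hF.lie_frameX_frameX, hF.lie_frameX_frameX, lie_smul, lie_smul,
      lie_smul] at hJ
    have key : ∀ i j l, e.repr (frameArray e j l • ⁅frameX e i, frameY e (j + l + 1 - w)⁆) =
        frameArray e j l • vecXY i (j + l + 1 - w) := by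
      intro i j l
      by_cases h : j + l < w
      · rw [frameArray_of_add_lt e j l h]; simp
      · rw [map_smul, hF.repr_lie_frameX_frameY _ (by omega)]
    have hJ' := congrArg e.repr hJ
    simp only [map_add, map_zero, key, smul_vecXY (frameArray_of_add_lt e)] at hJ'
    rw [if_neg (by omega), if_pos (by omega), if_neg (by omega), if_pos (by omega),
      if_neg (by omega), if_pos (by omega), zero_sub, zero_sub, zero_sub] at hJ'
    have hJn := congrArg (fun u => u FrameIndex.n) hJ'
    simp only [Finsupp.add_apply, Finsupp.neg_apply, Finsupp.single_eq_same,
      Finsupp.coe_zero, Pi.zero_apply] at hJn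
    rw [hanti l 0] at hJn
    simp at hJn
    linarith

theorem frameArray_zero_w (hF : A.IsFrame e) (hk : 1 ≤ k) : frameArray e 0 w = 1 := by
  have h := hF.x_x
  rw [hF.lie_frameX_frameX, show 0 + w + 1 - w = 1 by omega] at h
  have h1 : frameY e 1 ≠ 0 := frameY_ne_zero ⟨le_rfl, hk⟩
  refine smul_left_injective ℝ h1 ?_
  simpa using h

/-- Only the brackets of two `x`'s carry information beyond `k` and `w`. The rest follows from the
eigenvalues of `a` and `b`, the strings under `E` and `c`, and the absence of second degrees below
`-3`. -/
theorem repr_lie (hF : A.IsFrame e) (hk : 1 ≤ k) (p q : FrameIndex k w) :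
    e.repr ⁅e p, e q⁆ = bracketTable (frameArray e) p q := by
  have sw : ∀ p q, e.repr ⁅e q, e p⁆ = bracketTable (frameArray e) q p →
      e.repr ⁅e p, e q⁆ = bracketTable (frameArray e) p q := by
    intro p q h
    rw [← lie_skew, map_neg, h, ← bracketTable_antisymm hF.isBracketArray]
  have ha : ∀ q, e.repr ⁅e .a, e q⁆ = bracketTable (frameArray e) .a q := by
    intro q
    rw [hF.lie_a hk, map_smul, e.repr_self, bracketTable, Finsupp.smul_single, smul_eq_mul, mul_one]
  have hb : ∀ q, e.repr ⁅e .b, e q⁆ = bracketTable (frameArray e) .b q := by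
    intro q
    rw [hF.lie_b hk, map_smul, e.repr_self, bracketTable_b, Finsupp.smul_single, smul_eq_mul,
      mul_one]
  have hEx : ∀ j, e.repr ⁅e .E, e (.x j)⁆ = bracketTable (frameArray e) .E (.x j) := by
    intro j
    rw [apply_x, hF.lie_E_frameX, repr_frameX, bracketTable]
  have hEy : ∀ j, e.repr ⁅e .E, e (.y j)⁆ = bracketTable (frameArray e) .E (.y j) := by
    intro j
    rw [apply_y, hF.lie_E_frameY (by omega), repr_frameY, bracketTable]
  have hEz : e.repr ⁅e .E, e .z⁆ = bracketTable (frameArray e) .E .z := by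
    rw [hF.E_z, e.repr_self, bracketTable]
  have hEn : e.repr ⁅e .E, e .n⁆ = bracketTable (frameArray e) .E .n := by
    rw [hF.lie_E_n, map_zero]; rfl
  have hcE : ∀ h, e.repr ⁅e (.c h), e .E⁆ = bracketTable (frameArray e) (.c h) .E := by
    intro h
    rw [hF.c_E, bracketTable]
    simp
  have hcx : ∀ h j, e.repr ⁅e (.c h), e (.x j)⁆ = bracketTable (frameArray e) (.c h) (.x j) := by
    intro h j
    rw [apply_x, hF.lie_c_frameX, map_smul, repr_frameX, bracketTable]
  have hcy : ∀ h j, e.repr ⁅e (.c h), e (.y j)⁆ = bracketTable (frameArray e) (.c h) (.y j) := by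
    intro h j
    rw [apply_y, hF.lie_c_frameY _ (by omega), map_smul, repr_frameY, bracketTable]
    congr 1
    push_cast
    ring
  have hcz : ∀ h, e.repr ⁅e (.c h), e .z⁆ = bracketTable (frameArray e) (.c h) .z := by
    intro h
    rw [hF.lie_c_z, map_zero]; rfl
  have hcn : ∀ h, e.repr ⁅e (.c h), e .n⁆ = bracketTable (frameArray e) (.c h) .n := by
    intro h
    rw [hF.lie_c_n hk, e.repr_self, bracketTable]
  have hxx : ∀ i j, e.repr ⁅e (.x i), e (.x j)⁆ = bracketTable (frameArray e) (.x i) (.x j) := by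
    intro i j
    rw [apply_x, apply_x, hF.lie_frameX_frameX, map_smul, repr_frameY, bracketTable]
  have hxy : ∀ i j, e.repr ⁅e (.x i), e (.y j)⁆ = bracketTable (frameArray e) (.x i) (.y j) := by
    intro i j
    rw [apply_x, apply_y, hF.repr_lie_frameX_frameY _ (by omega), bracketTable]
  have hlow : ∀ p q : FrameIndex k w, p.bidegree.2 + q.bidegree.2 < -3 →
      e.repr ⁅e p, e q⁆ = bracketTable (frameArray e) p q := by
    intro p q h
    have h4 : ∀ r : FrameIndex k w, r.bidegree ≠ p.bidegree + q.bidegree := by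
      intro r hr
      have h5 := congrArg Prod.snd hr
      rw [Prod.snd_add] at h5
      have : (-3 : ℤ) ≤ r.bidegree.2 := by cases r <;> simp [FrameIndex.bidegree]
      omega
    rw [hF.eq_zero (lie_mem (hF.mem_grading p) (hF.mem_grading q)) h4,
      eq_zero_of_mem_homogeneous (bracketTable_mem_homogeneous hF.isBracketArray p q) h4, map_zero]
  have hself : ∀ p, e.repr ⁅e p, e p⁆ = bracketTable (frameArray e) p p := by
    intro p
    rw [lie_self, map_zero]
    exact (self_eq_neg.1 (bracketTable_antisymm hF.isBracketArray p p)).symm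
  by_cases hdeg : p.bidegree.2 + q.bidegree.2 < -3
  · exact hlow p q hdeg
  cases p with
  | a => exact ha q
  | b => exact hb q
  | E =>
    cases q with
    | a => exact sw _ _ (ha _)
    | b => exact sw _ _ (hb _)
    | E => exact hself _
    | x j => exact hEx j
    | y j => exact hEy j
    | z => exact hEz
    | n => exact hEn
    | c h => exact sw _ _ (hcE h)
  | c h =>
    cases q with
    | a => exact sw _ _ (ha _)
    | b => exact sw _ _ (hb _)
    | E => exact hcE h
    | x j => exact hcx h j
    | y j => exact hcy h j
    | z => exact hcz h
    | n => exact hcn h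
    | c h => exact hself _
  | x i =>
    cases q with
    | a => exact sw _ _ (ha _)
    | b => exact sw _ _ (hb _)
    | E => exact sw _ _ (hEx i)
    | c h => exact sw _ _ (hcx h i)
    | x j => exact hxx i j
    | y j => exact hxy i j
    | _ => simp [FrameIndex.bidegree] at hdeg
  | y i =>
    cases q with
    | a => exact sw _ _ (ha _)
    | b => exact sw _ _ (hb _)
    | E => exact sw _ _ (hEy i)
    | c h => exact sw _ _ (hcy h i)
    | x j => exact sw _ _ (hxy j i)
    | _ => simp [FrameIndex.bidegree] at hdeg
  | z =>
    cases q with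
    | a => exact sw _ _ (ha _)
    | b => exact sw _ _ (hb _)
    | E => exact sw _ _ hEz
    | c h => exact sw _ _ (hcz h)
    | _ => simp [FrameIndex.bidegree] at hdeg
  | n =>
    cases q with
    | a => exact sw _ _ (ha _)
    | b => exact sw _ _ (hb _)
    | E => exact sw _ _ hEn
    | c h => exact sw _ _ (hcn h)
    | _ => simp [FrameIndex.bidegree] at hdeg

theorem structureConstants_eq (hF : A.IsFrame e) (hk : 1 ≤ k) :
    structureConstants e = fun p q r => bracketTable (frameArray e) p q r := by
  funext p q r
  rw [structureConstants, hF.repr_lie hk]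

/-- The coefficients do not depend on the frame and are the same for isomorphic algebras. -/
theorem frameArray_eq {B : BigradedLieAlgebra.{u}} {e' : Module.Basis (FrameIndex k w) ℝ B}
    (hF : A.IsFrame e) (hF' : B.IsFrame e') (φ : A ≃ₗ⁅ℝ⁆ B)
    (hφ : ∀ (p : ℤ × ℤ) (v : A), φ v ∈ B.grading p ↔ v ∈ A.grading p) :
    frameArray e = frameArray e' := by
  -- The components of bi-degree `(-1, 0)` and `(0, -1)` are the lines of `E` and `x_0`, so `φ` acts
  -- on these generators by nonzero scalars `r` and `s`.
  obtain ⟨r, hr⟩ : ∃ r : ℝ, φ (e .E) = r • e' .E := by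
    refine ⟨_, hF'.eq_smul ((hφ _ _).2 (hF.mem_grading .E)) .E fun q hq => ?_⟩
    cases q <;> simp [FrameIndex.bidegree] at hq ⊢
  obtain ⟨s, hs⟩ : ∃ s : ℝ, φ (frameX e 0) = s • frameX e' 0 := by
    have h0 : frameX e' 0 = e' (.x ⟨0, by omega⟩) := dif_pos (by omega)
    rw [h0]
    refine ⟨_, hF'.eq_smul ((hφ _ _).2 (hF.frameX_mem 0)) _ fun q hq => ?_⟩
    cases q <;> simp [FrameIndex.bidegree] at hq ⊢
    exact hq
  have hr0 : r ≠ 0 := by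
    rintro rfl
    rw [zero_smul] at hr
    exact e.ne_zero _ (φ.injective (hr.trans (map_zero φ).symm))
  have hs0 : s ≠ 0 := by
    rintro rfl
    rw [zero_smul] at hs
    have h0 : frameX e 0 = e (.x ⟨0, by omega⟩) := dif_pos (by omega)
    rw [h0] at hs
    exact e.ne_zero _ (φ.injective (hs.trans (map_zero φ).symm))
  have hX : ∀ j, φ (frameX e j) = (r ^ j * s) • frameX e' j := by
    intro j
    induction j with
    | zero => simpa using hs
    | succ j ih =>
      rw [← hF.lie_E_frameX, LieEquiv.map_lie, hr, ih, smul_lie, lie_smul, hF'.lie_E_frameX,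
        smul_smul]
      congr 1
      ring
  have hY : ∀ j, 1 ≤ j → φ (frameY e j) = (r ^ (w + j - 1) * s ^ 2) • frameY e' j := by
    intro j hj
    induction j, hj using Nat.le_induction with
    | base =>
      rw [← hF.x_x, LieEquiv.map_lie, hX, hX, smul_lie, lie_smul, hF'.x_x, smul_smul,
        Nat.add_sub_cancel]
      congr 1
      ring
    | succ j hj ih =>
      rw [← hF.lie_E_frameY hj, LieEquiv.map_lie, hr, ih, smul_lie, lie_smul, hF'.lie_E_frameY hj,
        smul_smul, show w + (j + 1) - 1 = w + j - 1 + 1 by omega]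
      congr 1
      ring
  funext i j
  by_cases h : w ≤ i + j ∧ i + j < w + k
  · have h1 := congrArg φ (hF.lie_frameX_frameX i j)
    rw [LieEquiv.map_lie, hX, hX, smul_lie, lie_smul, hF'.lie_frameX_frameX, map_smul,
      hY _ (by omega), smul_smul, smul_smul, smul_smul,
      show w + (i + j + 1 - w) - 1 = i + j by omega] at h1
    have h2 : frameY e' (i + j + 1 - w) ≠ 0 := frameY_ne_zero (by omega)
    have h3 := smul_left_injective ℝ h2 h1
    -- The product of the scalars of `x_i` and `x_j` equals the scalar of `y_{i+j+1-w}`, so the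
    -- common factor cancels.
    have h4 : r ^ (i + j) * s ^ 2 ≠ 0 := by positivity
    apply mul_right_cancel₀ h4
    rw [← h3]
    ring
  · rw [frameArray, frameArray, dif_neg h, dif_neg h]

end IsFrame

theorem isomorphic_of_structureConstants_eq {B : BigradedLieAlgebra.{u}}
    {e' : Module.Basis (FrameIndex k w) ℝ B} (hF : A.IsFrame e) (hF' : B.IsFrame e')
    (h : structureConstants e = structureConstants e') : Isomorphic A B := by
  have hlie : ∀ p q, e.repr ⁅e p, e q⁆ = e'.repr ⁅e' p, e' q⁆ := fun p q =>
    Finsupp.ext fun r => congrFun (congrFun (congrFun h p) q) r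
  let f : A ≃ₗ[ℝ] B := e.repr.trans e'.repr.symm
  have hf : ∀ v, e'.repr (f v) = e.repr v := fun v => by simp [f]
  have hfe : ∀ p, f (e p) = e' p := fun p => by
    apply e'.repr.injective
    rw [hf, e.repr_self, e'.repr_self]
  have hmap : ∀ u v : A, f ⁅u, v⁆ = ⁅f u, f v⁆ := by
    intro u v
    have h1 : (LieModule.toEnd ℝ A A : A →ₗ[ℝ] A →ₗ[ℝ] A).compr₂ f.toLinearMap =
        (LieModule.toEnd ℝ B B : B →ₗ[ℝ] B →ₗ[ℝ] B).compl₁₂ f.toLinearMap f.toLinearMap := by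
      refine e.ext fun p => e.ext fun q => ?_
      simp only [LinearMap.compr₂_apply, LinearMap.compl₁₂_apply, LieHom.coe_toLinearMap,
        LieModule.toEnd_apply_apply, LinearEquiv.coe_coe]
      apply e'.repr.injective
      rw [hf, hfe, hfe, hlie]
    exact LinearMap.congr_fun₂ h1 u v
  refine ⟨{ f with map_lie' := fun {u v} => hmap u v }, fun p v => ?_⟩
  rw [hF.mem_grading_iff, hF'.mem_grading_iff]
  change e'.repr (f v) ∈ _ ↔ _
  rw [hf]

end Coefficients

end BigradedLieAlgebra

/-! ### The parametric family of isomorphism classes. -/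

namespace BigradedLieAlgebra

open Finsupp (single)

section Family

variable {k w : ℕ}

/-- The part of the bracket table that depends on the array, as a linear map. -/
noncomputable def tableLinear (k w : ℕ) :
    (ℕ → ℕ → ℝ) →ₗ[ℝ] (FrameIndex k w → FrameIndex k w → FrameIndex k w → ℝ) where
  toFun α p q r := match p, q with
    | .x i, .x j => α i j * (vecY (i + j + 1 - w) : FrameIndex k w →₀ ℝ) r
    | _, _ => 0
  map_add' α β := by
    funext p q r
    cases p <;> cases q <;> simp [add_mul]
  map_smul' c α := by
    funext p q r
    cases p <;> cases q <;> simp [mul_assoc]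

theorem bracketTable_add (α β : ℕ → ℕ → ℝ) (p q r : FrameIndex k w) :
    bracketTable (α + β) p q r = bracketTable α p q r + tableLinear k w β p q r := by
  cases p <;> cases q <;> simp [bracketTable, tableLinear, add_mul]

theorem bracketTable_injective {α β : ℕ → ℕ → ℝ} (hα : IsBracketArray k w α)
    (hβ : IsBracketArray k w β)
    (h : ∀ p q r : FrameIndex k w, bracketTable α p q r = bracketTable β p q r) : α = β := by
  funext i j
  by_cases hi : k < i
  · rw [hα.eq_zero_of_lt i j hi, hβ.eq_zero_of_lt i j hi]
  by_cases hj : k < j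
  · rw [hα.antisymm, hβ.antisymm, hα.eq_zero_of_lt j i hj, hβ.eq_zero_of_lt j i hj]
  by_cases h1 : i + j < w
  · rw [hα.eq_zero_of_add_lt i j h1, hβ.eq_zero_of_add_lt i j h1]
  by_cases h2 : w + k ≤ i + j
  · rw [hα.eq_zero_of_le_add i j h2, hβ.eq_zero_of_le_add i j h2]
  have h3 := h (.x ⟨i, by omega⟩) (.x ⟨j, by omega⟩) (.y ⟨i + j + 1 - w - 1, by omega⟩)
  rw [bracketTable, bracketTable, vecY_eq (by simp only; omega)] at h3
  simpa using h3

theorem frameArray_modelFrame {h : ℕ → ℕ → ℕ → ℝ} (hh : IsTripleArray k w h) (hk : 1 ≤ k)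
    (h1 : bracketArray k w h 0 w = 1) :
    frameArray (modelFrame.{u} hh) = bracketArray k w h := by
  have hF := modelFrame_isFrame.{u} hh hk h1
  refine bracketTable_injective hF.isBracketArray hh.isBracketArray fun p q r => ?_
  have h2 := (hF.structureConstants_eq hk).symm.trans (structureConstants_modelFrame hh)
  exact congrFun (congrFun (congrFun h2 p) q) r

/-- The class of the model over `t` has array `α₀ + L t`. Invariance of the array and injectivity of
`L` give injectivity; surjectivity holds because the array of any frame is of this form and
determines the algebra. The structure constants are affine in `t` because the array enters the table
linearly. -/
theorem isParametricFamily {d : ℕ} (hk : 2 < k) (hw : Odd w) (hd : paramDim k w = d) :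
    IsParametricFamily.{u} k w d := by
  obtain ⟨α₀, L, hL, harr, hone, hall⟩ := exists_affine_parametrization hw hd
  choose h hh hhα using harr
  have hk1 : 1 ≤ k := by omega
  have h1 : ∀ t, bracketArray k w (h t) 0 w = 1 := fun t => by rw [hhα, hone]
  have hF : ∀ t, (model.{u} (hh t)).IsFrame (modelFrame (hh t)) :=
    fun t => modelFrame_isFrame (hh t) hk1 (h1 t)
  have hfa : ∀ t, frameArray (modelFrame.{u} (hh t)) = α₀ + L t := fun t => by
    rw [frameArray_modelFrame (hh t) hk1 (h1 t), hhα]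
  let M : (Fin d → ℝ) → {A : BigradedLieAlgebra.{u} // A.IsOfType k w} :=
    fun t => ⟨model (hh t), modelFrame (hh t), hF t⟩
  let Ψ : (Fin d → ℝ) → Classes.{u} k w := fun t => Quotient.mk (ofTypeSetoid k w) (M t)
  have hinj : Function.Injective Ψ := by
    intro t t' htt
    obtain ⟨φ, hφ⟩ : Isomorphic (model.{u} (hh t)) (model.{u} (hh t')) := Quotient.exact htt
    have h2 := (hF t).frameArray_eq (hF t') φ hφ
    rw [hfa, hfa] at h2
    exact hL (add_left_cancel h2)
  have hsurj : Function.Surjective Ψ := by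
    intro c
    induction c using Quotient.inductionOn with
    | _ A =>
      obtain ⟨A, e, he⟩ := A
      obtain ⟨t, ht⟩ := hall _ he.isBracketArray (he.frameArray_zero_w hk1)
      refine ⟨t, Quotient.sound ?_⟩
      refine isomorphic_of_structureConstants_eq (hF t) he ?_
      rw [(hF t).structureConstants_eq hk1, he.structureConstants_eq hk1, hfa, ht]
  refine ⟨Equiv.ofBijective Ψ ⟨hinj, hsurj⟩,
    ((tableLinear k w).comp L).toAffineMap +
      AffineMap.const ℝ _ (fun p q r => bracketTable α₀ p q r), ?_, ?_⟩
  · intro t t' htt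
    have h2 : α₀ + L t = α₀ + L t' := by
      rw [← hhα, ← hhα]
      refine bracketTable_injective (hh t).isBracketArray (hh t').isBracketArray fun p q r => ?_
      rw [hhα, hhα, bracketTable_add, bracketTable_add]
      have h3 := congrFun (congrFun (congrFun htt p) q) r
      simp only [AffineMap.coe_add, LinearMap.coe_toAffineMap, LinearMap.coe_comp, Pi.add_apply,
        Function.comp_apply, AffineMap.const_apply] at h3
      linarith
    exact hL (add_left_cancel h2)
  · intro A t htA e he
    obtain ⟨φ, hφ⟩ : Isomorphic (model.{u} (hh t)) A.1 := Quotient.exact htA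
    have h2 := (hF t).frameArray_eq he φ hφ
    rw [he.structureConstants_eq hk1, ← h2, hfa]
    funext p q r
    simp only [AffineMap.coe_add, LinearMap.coe_toAffineMap, LinearMap.coe_comp, Pi.add_apply,
      Function.comp_apply, AffineMap.const_apply, bracketTable_add]
    ring

theorem isEmpty_classes (hk : 2 < k) (hw : Odd w) (hd : paramDim k w < 0) :
    IsEmpty (Classes.{u} k w) := by
  refine ⟨fun c => ?_⟩
  induction c using Quotient.inductionOn with
  | _ A =>
    obtain ⟨A, e, he⟩ := A
    -- For negative `d` no coordinate is left (`D = 0`), so the array vanishes, against `α 0 w = 1`.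
    have h0 := he.isBracketArray.eq_zero hw 0 (paramDim_bound hw (by simpa using hd)) (by simp)
    have h1 := he.frameArray_zero_w (by omega)
    rw [h0] at h1
    simp at h1

end Family

end BigradedLieAlgebra

theorem theorem3 (k w : ℕ) (hk : 2 < k) (hw : Odd w) :
    (∀ d : ℕ, BigradedLieAlgebra.paramDim k w = d →
      BigradedLieAlgebra.IsParametricFamily.{u} k w d) ∧
    (BigradedLieAlgebra.paramDim k w = 0 →
      Nonempty (Unique (BigradedLieAlgebra.Classes.{u} k w))) ∧
    (BigradedLieAlgebra.paramDim k w < 0 →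
      IsEmpty (BigradedLieAlgebra.Classes.{u} k w)) := by
  refine ⟨fun d hd => BigradedLieAlgebra.isParametricFamily hk hw hd, fun hd => ?_,
    BigradedLieAlgebra.isEmpty_classes hk hw⟩
  obtain ⟨Φ, -⟩ := BigradedLieAlgebra.isParametricFamily.{u} (d := 0) hk hw hd
  exact ⟨Φ.symm.unique⟩
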